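/- Let $G$ be a locally compact, second countable, Hausdorff topological group, $G_0\subset G$ a closed subgroup, and $X=G/G_0$ with the quotient Borel structure and the left action of $G$. Let $m:G\times G\to\mathbf T$ be a (normalized) multiplier, i.e. a Borel map with $m(ab,c)\,m(a,b)=m(a,bc)\,m(b,c)$ and $m(e,g)=m(g,e)=1$. An $m$-representation of $G$ (or of $G_0$, with $m|_{G_0\times G_0}$) in a Hilbert space is a weakly Borel map $U$ into its unitary group with $U_{gh}=m(g,h)U_gU_h$. An $m$-system of imprimitivity $(U,P)$ for $G$ based on $X$ and acting in a Hilbert space $\mathcal H$ is an $m$-representation $U$ of $G$ in $\mathcal H$ together with a projection valued measure $P$ on $X$ acting in $\mathcal H$ such that $U_gP_EU_g^{-1}=P_{g\cdot E}$ for all $g\in G$ and all Borel $E\subset X$. The commuting ring of an $m$-representation $D$ (resp. of $(U,P)$) is the $*$-algebra of all bounded operators commuting with all $D(h)$ (resp. with all $U_g$ and all $P_E$); irreducible means that the space is nonzero and has no closed invariant subspace other than $0$ and the whole space; direct sums are Hilbert space direct sums, up to unitary equivalence. Let $\mathcal K$ be a separable complex Hilbert space and $D$ an $m|_{G_0\times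 G_0}$-representation of $G_0$ in $\mathcal K$. An $m$-system of imprimitivity $(U,P)$ for $G$ based on $X$ is said to be associated to $D$ if there are a $\sigma$-finite measure $\alpha$ in the invariant measure class of $X$ (i.e. $\alpha(A)=0$ if and only if the inverse image of $A$ in $G$ is a Haar null set) and a strict cocycle $\phi:G\times X\to\mathcal U(\mathcal K)$, that is, a Borel map with $\phi(e,x)=\mathbf 1$ and $\phi(g_1g_2,x)=m(g_1,g_2)\,\phi(g_1,g_2x)\,\phi(g_2,x)$ everywhere, such that $\phi(h,G_0)=D(h)$ for all $h\in G_0$ and $(U,P)$ is unitarily equivalent to an $m$-system of imprimitivity $(U',P')$ in $L^2(X,\mathcal K,\alpha)$ with $P'_Ef=\chi_Ef$ and, for almost all $g\in G$, $$(U'_gf)(x)=r_g(g^{-1}x)^{1/2}\,\phi(g,g^{-1}x)\,f(g^{-1}x)\quad\text{for all } f \text{ and almost all } x,$$ where $r_g$ is the Radon–Nikodym derivative of $\alpha$ with respect to the measure $E\mapsto\alpha(g\cdot E)$. (1) If $(U,P)$ is associated to $D$, then the commuting ring of $D$ is isomorphic, as a $*$-algebra, to the commuting ring of $(U,P)$,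 and $D$ is irreducible if and only if $(U,P)$ is irreducible. (2) Let $(D_i)$ be a countable family of $m|_{G_0\times G_0}$-representations of $G_0$ in separable Hilbert spaces and let $(U_i,P_i)$ be an $m$-system of imprimitivity associated to $D_i$ for each $i$. If $D$ is the direct sum of the $D_i$, then $(U,P)$ is associated to $D$ if and only if $(U,P)$ is the direct sum of the $(U_i,P_i)$. If $(U,P)$ is the direct sum of the $(U_i,P_i)$, then $(U,P)$ is associated to $D$ if and only if $D$ is the direct sum of the $D_i$. -/

import Mathlib

open MeasureTheory
open scoped InnerProductSpace

noncomputable section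

/-- A multiplier of a Borel group `G` with values in the circle group (normalized at `1`). -/
structure Multiplier (G : Type*) [Group G] [MeasurableSpace G] where
  toFun : G → G → Circle
  measurable' : Measurable (fun p : G × G => (toFun p.1 p.2 : ℂ))
  mul_mul' : ∀ a b c, toFun (a * b) c * toFun a b = toFun a (b * c) * toFun b c
  one_left' : ∀ g, toFun 1 g = 1
  one_right' : ∀ g, toFun g 1 = 1

instance {G : Type*} [Group G] [MeasurableSpace G] :
    CoeFun (Multiplier G) (fun _ => G → G → Circle) := ⟨Multiplier.toFun⟩

/-- The restriction of a multiplier to a subgroup. -/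
def Multiplier.restrict {G : Type*} [Group G] [MeasurableSpace G] (m : Multiplier G)
    (G₀ : Subgroup G) : Multiplier G₀ where
  toFun a b := m a b
  measurable' := m.measurable'.comp
    ((measurable_subtype_coe.comp measurable_fst).prodMk
      (measurable_subtype_coe.comp measurable_snd))
  mul_mul' a b c := m.mul_mul' a b c
  one_left' g := m.one_left' g
  one_right' g := m.one_right' g

/-- An `m`-representation of `G` in the Hilbert space `H`: a (weakly) Borel map `U` into the
unitary group of `H` with `U (g h) = m(g, h) U g U h`. -/
structure MRep {G : Type*} [Group G] [MeasurableSpace G] (m : Multiplier G)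
    (H : Type*) [NormedAddCommGroup H] [InnerProductSpace ℂ H] where
  U : G → (H ≃ₗᵢ[ℂ] H)
  map_mul : ∀ g h v, U (g * h) v = (m g h : ℂ) • U g (U h v)
  measurable_inner : ∀ v w, Measurable (fun g => ⟪v, U g w⟫_ℂ)

/-- A projection valued measure on the Borel space `X` acting in `H`
(only its values on measurable sets are meaningful). -/
structure ProjMeasure (X : Type*) [MeasurableSpace X]
    (H : Type*) [NormedAddCommGroup H] [InnerProductSpace ℂ H] [CompleteSpace H] where
  P : Set X → (H →L[ℂ] H)
  isStarProjection : ∀ E, MeasurableSet E → IsStarProjection (P E)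
  univ : P Set.univ = 1
  inter : ∀ E F, MeasurableSet E → MeasurableSet F → P (E ∩ F) = P E * P F
  hasSum_iUnion : ∀ E : ℕ → Set X, (∀ n, MeasurableSet (E n)) →
    Pairwise (fun i j => Disjoint (E i) (E j)) →
    ∀ v, HasSum (fun n => P (E n) v) (P (⋃ n, E n) v)

/-- An `m`-system of imprimitivity `(U, P)` for `G` based on `X` and acting in `H`:
`U g ∘ P E ∘ (U g)⁻¹ = P (g • E)`. -/
structure MSystem {G : Type*} [Group G] [MeasurableSpace G] (m : Multiplier G)
    (X : Type*) [MeasurableSpace X] [MulAction G X]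
    (H : Type*) [NormedAddCommGroup H] [InnerProductSpace ℂ H] [CompleteSpace H]
    extends MRep m H, ProjMeasure X H where
  covariant : ∀ g E, MeasurableSet E →
    ∀ v, U g (P E ((U g).symm v)) = P ((fun x => g • x) '' E) v

section Notions

variable {G : Type*} [Group G] [MeasurableSpace G] {m : Multiplier G}
  {X : Type*} [MeasurableSpace X] [MulAction G X]

/-- If a bounded operator commutes with a unitary, so does its adjoint. -/
theorem star_comm_of_comm {H : Type*} [NormedAddCommGroup H] [InnerProductSpace ℂ H]
    [CompleteSpace H] (u : H ≃ₗᵢ[ℂ] H) (T : H →L[ℂ] H) (h : ∀ v, T (u v) = u (T v)) (v : H) :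
    (star T) (u v) = u ((star T) v) := by
  refine ext_inner_right ℂ fun w => ?_
  have h1 : T (u.symm w) = u.symm (T w) := by
    apply u.injective
    rw [← h]
    simp
  have key : ∀ a b : H, ⟪u a, b⟫_ℂ = ⟪a, u.symm b⟫_ℂ := fun a b => by
    rw [← u.inner_map_map a (u.symm b), u.apply_symm_apply]
  rw [ContinuousLinearMap.star_eq_adjoint, ContinuousLinearMap.adjoint_inner_left, key, key,
    ContinuousLinearMap.adjoint_inner_left, h1]

/-- The commuting ring of an `m`-representation: all bounded operators commuting with every
`U g`; it is a `*`-algebra. -/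
def MRep.commutingRing {H : Type*} [NormedAddCommGroup H] [InnerProductSpace ℂ H]
    [CompleteSpace H] (D : MRep m H) : StarSubalgebra ℂ (H →L[ℂ] H) where
  carrier := {T | ∀ g v, T (D.U g v) = D.U g (T v)}
  mul_mem' := by
    intro S T hS hT g v
    simp only [Set.mem_ofPred_eq, mul_apply_eq_comp] at *
    rw [hT, hS]
  add_mem' := by
    intro S T hS hT g v
    simp only [Set.mem_ofPred_eq, add_apply] at *
    rw [hS, hT, map_add]
  algebraMap_mem' := by
    intro r g v
    simp [Algebra.algebraMap_eq_smul_one]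
  star_mem' := by
    intro T hT g v
    exact star_comm_of_comm _ _ (hT g) v

/-- The commuting ring of an `m`-system of imprimitivity `(U, P)`: all bounded operators
commuting with every `U g` and with every `P E`, `E` Borel; it is a `*`-algebra. -/
def MSystem.commutingRing {H : Type*} [NormedAddCommGroup H] [InnerProductSpace ℂ H]
    [CompleteSpace H] (S : MSystem m X H) : StarSubalgebra ℂ (H →L[ℂ] H) where
  carrier := {T | (∀ g v, T (S.U g v) = S.U g (T v)) ∧
    ∀ E, MeasurableSet E → T * S.P E = S.P E * T}
  mul_mem' := by
    rintro A B ⟨hA, hA'⟩ ⟨hB, hB'⟩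
    refine ⟨fun g v => ?_, fun E hE => ?_⟩
    · simp only [mul_apply_eq_comp]
      rw [hB, hA]
    · rw [mul_assoc, hB' E hE, ← mul_assoc, hA' E hE, mul_assoc]
  add_mem' := by
    rintro A B ⟨hA, hA'⟩ ⟨hB, hB'⟩
    refine ⟨fun g v => ?_, fun E hE => ?_⟩
    · simp only [add_apply]
      rw [hA, hB, map_add]
    · rw [add_mul, mul_add, hA' E hE, hB' E hE]
  algebraMap_mem' := by
    intro r
    refine ⟨fun g v => ?_, fun E hE => Algebra.commutes r _⟩
    simp [Algebra.algebraMap_eq_smul_one]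
  star_mem' := by
    rintro T ⟨hT, hT'⟩
    refine ⟨fun g v => star_comm_of_comm _ _ (hT g) v, fun E hE => ?_⟩
    have h1 := congrArg star (hT' E hE)
    rw [star_mul, star_mul, (S.isStarProjection E hE).isSelfAdjoint.star_eq] at h1
    exact h1.symm

/-- Irreducibility of an `m`-representation: the space is nonzero and there are no closed
invariant subspaces other than `0` and the whole space. -/
def MRep.IsIrreducible {H : Type*} [NormedAddCommGroup H] [InnerProductSpace ℂ H]
    (D : MRep m H) : Prop :=
  Nontrivial H ∧ ∀ V : Submodule ℂ H, IsClosed (V : Set H) →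
    (∀ g, ∀ v ∈ V, D.U g v ∈ V) → V = ⊥ ∨ V = ⊤

/-- Irreducibility of an `m`-system of imprimitivity: the space is nonzero and there are no
closed subspaces invariant under all `U g` and all `P E` other than `0` and the whole space. -/
def MSystem.IsIrreducible {H : Type*} [NormedAddCommGroup H] [InnerProductSpace ℂ H]
    [CompleteSpace H] (S : MSystem m X H) : Prop :=
  Nontrivial H ∧ ∀ V : Submodule ℂ H, IsClosed (V : Set H) →
    (∀ g, ∀ v ∈ V, S.U g v ∈ V) → (∀ E, MeasurableSet E → ∀ v ∈ V, S.P E v ∈ V) →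
    V = ⊥ ∨ V = ⊤

/-- `D` is (unitarily equivalent to) the Hilbert space direct sum of the `m`-representations
`D' i`: the space of `D` is the Hilbert sum of the spaces of the `D' i`, via isometric embeddings
`V i` intertwining `D' i` with `D`. -/
def MRep.IsDirectSum {H : Type*} [NormedAddCommGroup H] [InnerProductSpace ℂ H]
    [CompleteSpace H] (D : MRep m H) {ι : Type*} {H' : ι → Type*}
    [∀ i, NormedAddCommGroup (H' i)] [∀ i, InnerProductSpace ℂ (H' i)]
    (D' : ∀ i, MRep m (H' i)) : Prop :=
  ∃ V : ∀ i, H' i →ₗᵢ[ℂ] H, IsHilbertSum ℂ H' V ∧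
    ∀ i g v, D.U g (V i v) = V i ((D' i).U g v)

/-- `S` is (unitarily equivalent to) the Hilbert space direct sum of the `m`-systems of
imprimitivity `S' i`. -/
def MSystem.IsDirectSum {H : Type*} [NormedAddCommGroup H] [InnerProductSpace ℂ H]
    [CompleteSpace H] (S : MSystem m X H) {ι : Type*} {H' : ι → Type*}
    [∀ i, NormedAddCommGroup (H' i)] [∀ i, InnerProductSpace ℂ (H' i)]
    [∀ i, CompleteSpace (H' i)] (S' : ∀ i, MSystem m X (H' i)) : Prop :=
  ∃ V : ∀ i, H' i →ₗᵢ[ℂ] H, IsHilbertSum ℂ H' V ∧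
    (∀ i g v, S.U g (V i v) = V i ((S' i).U g v)) ∧
    ∀ i E, MeasurableSet E → ∀ v, S.P E (V i v) = V i ((S' i).P E v)

/-- Unitary equivalence of `m`-systems of imprimitivity. -/
def MSystem.IsEquivalent {H : Type*} [NormedAddCommGroup H] [InnerProductSpace ℂ H]
    [CompleteSpace H] {H' : Type*} [NormedAddCommGroup H'] [InnerProductSpace ℂ H']
    [CompleteSpace H'] (S : MSystem m X H) (S' : MSystem m X H') : Prop :=
  ∃ W : H ≃ₗᵢ[ℂ] H', (∀ g v, W (S.U g v) = S'.U g (W v)) ∧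
    ∀ E, MeasurableSet E → ∀ v, W (S.P E v) = S'.P E (W v)

/-- A strict `m`-`(G, X, 𝒰(K))`-cocycle, `𝒰(K)` being the unitary group of `K`. -/
structure StrictCocycle {G : Type*} [Group G] [MeasurableSpace G] (m : Multiplier G)
    (X : Type*) [MeasurableSpace X] [MulAction G X]
    (K : Type*) [NormedAddCommGroup K] [InnerProductSpace ℂ K] where
  f : G → X → (K ≃ₗᵢ[ℂ] K)
  measurable_inner : ∀ v w, Measurable (fun p : G × X => ⟪v, f p.1 p.2 w⟫_ℂ)
  map_one : ∀ x v, f 1 x v = v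
  map_mul : ∀ g₁ g₂ x v,
    f (g₁ * g₂) x v = (m g₁ g₂ : ℂ) • f g₁ (g₂ • x) (f g₂ x v)

/-- The Radon-Nikodym derivative `r_g = dα / dα^{g⁻¹}`, where `α^{g⁻¹}(E) = α(g • E)`. -/
def radonNikodym (α : Measure X) (g : G) (x : X) : ℝ :=
  (α.rnDeriv (α.map (fun y => g⁻¹ • y)) x).toReal

/-- The `m`-system of imprimitivity `S = (U, P)` in `L²(X, K, α)` is the one defined by the
cocycle `φ`: `P E F = χ_E F` and, for almost all `g`,
`(U g F)(x) = r_g(g⁻¹ x)^{1/2} φ(g, g⁻¹ x) F(g⁻¹ x)` for almost all `x`. -/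
def IsCocycleSystem [TopologicalSpace G] [IsTopologicalGroup G] [LocallyCompactSpace G]
    [BorelSpace G] {K : Type*} [NormedAddCommGroup K] [InnerProductSpace ℂ K] [CompleteSpace K]
    (α : Measure X) (φ : StrictCocycle m X K) (S : MSystem m X (Lp K 2 α)) : Prop :=
  (∀ E, MeasurableSet E → ∀ F : Lp K 2 α, S.P E F =ᵐ[α] E.indicator F) ∧
  ∀ᵐ g ∂(Measure.haar : Measure G), ∀ F : Lp K 2 α,
    S.U g F =ᵐ[α] fun x =>
      ((Real.sqrt (radonNikodym α g (g⁻¹ • x)) : ℝ) : ℂ) • φ.f g (g⁻¹ • x) (F (g⁻¹ • x))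

/-- `α` is a `σ`-finite measure in the invariant measure class of the homogeneous space `G ⧸ G₀`:
its null sets are those Borel sets whose inverse image in `G` is a null set for Haar measure. -/
def InInvariantClass [TopologicalSpace G] [IsTopologicalGroup G] [LocallyCompactSpace G]
    [BorelSpace G] {G₀ : Subgroup G} (α : Measure (G ⧸ G₀)) : Prop :=
  SigmaFinite α ∧ ∀ A : Set (G ⧸ G₀), MeasurableSet A →
    (α A = 0 ↔ (Measure.haar : Measure G) ((fun g : G => (g : G ⧸ G₀)) ⁻¹' A) = 0)

/-- The `m`-system of imprimitivity `S` based on `G ⧸ G₀` is associated to the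
`m`-representation `D` of `G₀`: `S` is equivalent to the system in `L²(G ⧸ G₀, K, α)` given by a
strict `m`-cocycle `φ` that defines `D` at the base point, i.e. `φ(h, G₀) = D(h)` for `h ∈ G₀`,
`α` being a `σ`-finite measure in the invariant measure class. -/
def IsAssociated [TopologicalSpace G] [IsTopologicalGroup G] [LocallyCompactSpace G]
    [BorelSpace G] {G₀ : Subgroup G}
    {K : Type*} [NormedAddCommGroup K] [InnerProductSpace ℂ K] [CompleteSpace K]
    {H : Type*} [NormedAddCommGroup H] [InnerProductSpace ℂ H] [CompleteSpace H]
    (D : MRep (m.restrict G₀) K) (S : MSystem m (G ⧸ G₀) H) : Prop :=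
  ∃ α : Measure (G ⧸ G₀), InInvariantClass α ∧
    ∃ φ : StrictCocycle m (G ⧸ G₀) K,
      (∀ h : G₀, φ.f (h : G) ((1 : G) : G ⧸ G₀) = D.U h) ∧
      ∃ S' : MSystem m (G ⧸ G₀) (Lp K 2 α), IsCocycleSystem α φ S' ∧ S.IsEquivalent S'

end Notions

end

/-! Write x₀ for the base point of `G ⧸ G₀`. The theorem rests on a fully faithful, adjoint
preserving correspondence between intertwiners of representations of `G₀` and intertwiners of the
associated systems. Given T from `D` to `D'`, the operator φ'(g, x₀) T φ(g, x₀)⁻¹ depends only on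
the coset of g, because φ(gh, x₀) = m(g, h) φ(g, x₀) D(h) and the multiplier cancels. This gives a
bounded measurable field on `G ⧸ G₀`, hence a decomposable operator between the L² spaces
(`inducedOp`, and `liftOp` on the abstract spaces), which intertwines the two systems.

Conversely, an operator commuting with the projections is decomposable
(`CommutesWithIndicators.exists_field`), with some field t. Commutation with the unitaries makes
s(g) = φ'(g, x₀)⁻¹ t(gx₀) φ(g, x₀) invariant under almost all left translations. By Fubini s is
almost everywhere constant, and its constant value is the intertwiner sought
(`exists_eq_inducedOp`).

Since the correspondence respects sums, products and adjoints, it gives the isomorphism of commuting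
rings. Irreducibility is the absence of nontrivial projections in the commuting ring, so it
transfers too. A direct sum decomposition amounts to intertwining isometries V_i with V_i* V_j = 0
for i ≠ j, jointly total as seen by the commutant. These are algebraic conditions, so they pass
through the correspondence in both directions (`IsModel.isDirectSum_iff`). It remains to see that a
direct sum of systems is associated to the direct sum of the representations, for which the cocycles
are summed (`exists_isModel_of_isDirectSum`). -/

open Filter Topology
open scoped ENNReal NNReal

set_option linter.unusedSectionVars false

/-! ### Measurable operator valued functions -/

section OperatorMeasurability

/-- In a separable Hilbert space, weakly measurable functions are strongly measurable. -/
theorem stronglyMeasurable_of_measurable_inner {Y K : Type*} [MeasurableSpace Y]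
    [NormedAddCommGroup K] [InnerProductSpace ℂ K] [CompleteSpace K]
    [TopologicalSpace.SeparableSpace K] {f : Y → K}
    (hf : ∀ v, Measurable fun y => ⟪v, f y⟫_ℂ) : StronglyMeasurable f := by
  obtain ⟨w, b, hb⟩ := exists_hilbertBasis ℂ K
  -- Distinct orthonormal vectors are √2 apart, so the balls of radius 1/2 around them are disjoint
  -- open sets, and separability leaves only countably many.
  have hw : w.Countable := by
    refine Set.PairwiseDisjoint.countable_of_isOpen (s := fun x : K => Metric.ball x (1 / 2))
      ?_ (fun x _ => Metric.isOpen_ball) (fun x _ => ⟨x, by simp⟩)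
    intro x hx y hy hxy
    refine Metric.ball_disjoint_ball ?_
    have ho := b.orthonormal
    rw [hb] at ho
    have hd : ‖x - y‖ ^ 2 = 2 := by
      have h1 := ho.1 ⟨x, hx⟩
      have h2 := ho.1 ⟨y, hy⟩
      have h3 : ⟪x, y⟫_ℂ = 0 := ho.2 (i := ⟨x, hx⟩) (j := ⟨y, hy⟩) (by simpa using hxy)
      simp only at h1 h2
      rw [@norm_sub_sq ℂ, h1, h2, h3]
      norm_num
    rw [dist_eq_norm]
    nlinarith [norm_nonneg (x - y)]
  have : Countable w := hw.to_subtype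
  refine stronglyMeasurable_of_tendsto (u := (atTop : Filter (Finset w)))
    (f := fun (s : Finset w) y => ∑ i ∈ s, ⟪b i, f y⟫_ℂ • b i) (fun s => ?_) ?_
  · refine Finset.stronglyMeasurable_fun_sum _ fun i _ => ?_
    exact (hf (b i)).stronglyMeasurable.smul_const _
  · rw [tendsto_pi_nhds]
    intro y
    have := b.hasSum_repr (f y)
    simp only [b.repr_apply_apply] at this
    exact this

variable {Y Z K K' K'' : Type*} [MeasurableSpace Y] [MeasurableSpace Z]
  [NormedAddCommGroup K] [InnerProductSpace ℂ K]
  [NormedAddCommGroup K'] [InnerProductSpace ℂ K']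
  [NormedAddCommGroup K''] [InnerProductSpace ℂ K'']

/-- Strong-operator measurability of an operator valued function. -/
def OpMeasurable (A : Y → K →L[ℂ] K') : Prop := ∀ v, StronglyMeasurable fun y => A y v

namespace OpMeasurable

theorem const (T : K →L[ℂ] K') : OpMeasurable fun _ : Y => T := fun _ =>
  stronglyMeasurable_const

theorem comp_measurable {A : Y → K →L[ℂ] K'} (hA : OpMeasurable A) {θ : Z → Y}
    (hθ : Measurable θ) : OpMeasurable fun z => A (θ z) := fun v =>
  (hA v).comp_measurable hθ

/-- (y, k) ↦ A y k is a Carathéodory function, continuous in k and measurable in y, hence jointly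
measurable since K is separable. -/
theorem stronglyMeasurable_apply [TopologicalSpace.SeparableSpace K] {A : Y → K →L[ℂ] K'}
    (hA : OpMeasurable A) {f : Y → K} (hf : StronglyMeasurable f) :
    StronglyMeasurable fun y => A y (f y) := by
  borelize K
  have : SecondCountableTopology K := UniformSpace.secondCountable_of_separable K
  have h := stronglyMeasurable_uncurry_of_continuous_of_stronglyMeasurable
    (u := fun (k : K) (y : Y) => A y k) (fun y => (A y).continuous) hA
  exact h.comp_measurable (hf.measurable.prodMk measurable_id)

theorem aestronglyMeasurable_apply [TopologicalSpace.SeparableSpace K] {A : Y → K →L[ℂ] K'}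
    (hA : OpMeasurable A) {μ : Measure Y} {f : Y → K} (hf : AEStronglyMeasurable f μ) :
    AEStronglyMeasurable (fun y => A y (f y)) μ := by
  refine ⟨fun y => A y (hf.mk f y), hA.stronglyMeasurable_apply hf.stronglyMeasurable_mk, ?_⟩
  filter_upwards [hf.ae_eq_mk] with y hy
  rw [← hy]

theorem comp [TopologicalSpace.SeparableSpace K'] {A : Y → K' →L[ℂ] K''} {B : Y → K →L[ℂ] K'}
    (hA : OpMeasurable A) (hB : OpMeasurable B) : OpMeasurable fun y => A y ∘L B y := fun v =>
  hA.stronglyMeasurable_apply (hB v)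

theorem smul {A : Y → K →L[ℂ] K'} (hA : OpMeasurable A) {c : Y → ℂ} (hc : Measurable c) :
    OpMeasurable fun y => c y • A y := fun v => hc.stronglyMeasurable.smul (hA v)

theorem of_inner [CompleteSpace K'] [TopologicalSpace.SeparableSpace K'] {A : Y → K →L[ℂ] K'}
    (h : ∀ v w, Measurable fun y => ⟪v, A y w⟫_ℂ) : OpMeasurable A := fun w =>
  stronglyMeasurable_of_measurable_inner fun v => h v w

theorem adjoint [CompleteSpace K] [CompleteSpace K'] [TopologicalSpace.SeparableSpace K]
    {A : Y → K →L[ℂ] K'} (hA : OpMeasurable A) :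
    OpMeasurable fun y => ContinuousLinearMap.adjoint (A y) := by
  refine of_inner fun v w => ?_
  simp only [ContinuousLinearMap.adjoint_inner_right]
  exact ((hA v).inner stronglyMeasurable_const).measurable

end OpMeasurable

/-- Two continuous operators agreeing on a dense sequence are equal. -/
theorem ContinuousLinearMap.ext_denseSeq [TopologicalSpace.SeparableSpace K]
    {A B : K →L[ℂ] K'} (h : ∀ n, A (TopologicalSpace.denseSeq K n) =
      B (TopologicalSpace.denseSeq K n)) : A = B := by
  apply DFunLike.coe_injective
  refine (TopologicalSpace.denseRange_denseSeq K).equalizer A.continuous B.continuous ?_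
  funext n
  exact h n

theorem OpMeasurable.measurableSet_eq [TopologicalSpace.SeparableSpace K]
    {A B : Y → K →L[ℂ] K'} (hA : OpMeasurable A) (hB : OpMeasurable B) :
    MeasurableSet {y | A y = B y} := by
  have : {y | A y = B y} = ⋂ n, {y | A y (TopologicalSpace.denseSeq K n) =
      B y (TopologicalSpace.denseSeq K n)} := by
    ext y
    simp only [Set.mem_iInter]
    exact ⟨fun h n => DFunLike.congr_fun h _, fun h => ContinuousLinearMap.ext_denseSeq h⟩
  rw [this]
  exact MeasurableSet.iInter fun n => (hA _).measurableSet_eq_fun (hB _)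

end OperatorMeasurability

/-! ### Weighted composition operators between L² spaces -/

section WeightedComposition

variable {X Y K K' : Type*} [MeasurableSpace X] [MeasurableSpace Y]
  [NormedAddCommGroup K] [InnerProductSpace ℂ K]
  [NormedAddCommGroup K'] [InnerProductSpace ℂ K']

/-- The data defining a bounded operator `f ↦ (y ↦ B y (f (θ y)))` from `L²(α)` to `L²(β)`. -/
structure IsWeightedComp (α : Measure X) (β : Measure Y) (θ : Y → X) (B : Y → K →L[ℂ] K') :
    Prop where
  quasi : Measure.QuasiMeasurePreserving θ β α
  meas : OpMeasurable B
  bound : ∃ C : ℝ≥0, ∀ f : X → K, AEStronglyMeasurable f α →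
    eLpNorm (fun y => B y (f (θ y))) 2 β ≤ C * eLpNorm f 2 α

namespace IsWeightedComp

variable [TopologicalSpace.SeparableSpace K] {α : Measure X} {β : Measure Y} {θ : Y → X}
  {B : Y → K →L[ℂ] K'}

theorem memLp (h : IsWeightedComp α β θ B) (f : Lp K 2 α) :
    MemLp (fun y => B y (f (θ y))) 2 β := by
  obtain ⟨C, hC⟩ := h.bound
  refine ⟨h.meas.aestronglyMeasurable_apply
    ((Lp.aestronglyMeasurable f).comp_quasiMeasurePreserving h.quasi), ?_⟩
  exact (hC f (Lp.aestronglyMeasurable f)).trans_lt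
    (ENNReal.mul_lt_top ENNReal.coe_lt_top (Lp.eLpNorm_lt_top f))

/-- The bounded operator `f ↦ (y ↦ B y (f (θ y)))`. -/
noncomputable def op (h : IsWeightedComp α β θ B) : Lp K 2 α →L[ℂ] Lp K' 2 β :=
  LinearMap.mkContinuousOfExistsBound
    { toFun := fun f => (h.memLp f).toLp
      map_add' := fun f g => by
        apply Lp.ext
        filter_upwards [(h.memLp (f + g)).coeFn_toLp, (h.memLp f).coeFn_toLp,
          (h.memLp g).coeFn_toLp, h.quasi.ae (Lp.coeFn_add f g),
          Lp.coeFn_add (h.memLp f).toLp (h.memLp g).toLp] with y h1 h2 h3 h4 h5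
        rw [h1, h5, Pi.add_apply, h2, h3, h4, Pi.add_apply, map_add]
      map_smul' := fun c f => by
        apply Lp.ext
        filter_upwards [(h.memLp (c • f)).coeFn_toLp, (h.memLp f).coeFn_toLp,
          h.quasi.ae (Lp.coeFn_smul c f),
          Lp.coeFn_smul c (h.memLp f).toLp] with y h1 h2 h4 h5
        rw [h1, RingHom.id_apply, h5, Pi.smul_apply, h2, h4, Pi.smul_apply, map_smul] }
    (by
      obtain ⟨C, hC⟩ := h.bound
      refine ⟨C, fun f => ?_⟩
      simp only [LinearMap.coe_mk, AddHom.coe_mk, Lp.norm_def]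
      rw [eLpNorm_congr_ae (h.memLp f).coeFn_toLp]
      rw [← ENNReal.coe_toReal, ← ENNReal.toReal_mul]
      exact ENNReal.toReal_mono
        (ENNReal.mul_ne_top ENNReal.coe_ne_top (Lp.eLpNorm_lt_top f).ne)
        (hC f (Lp.aestronglyMeasurable f)))

theorem coeFn_op (h : IsWeightedComp α β θ B) (f : Lp K 2 α) :
    h.op f =ᵐ[β] fun y => B y (f (θ y)) :=
  (h.memLp f).coeFn_toLp

end IsWeightedComp

/-- Multiplication by a bounded measurable operator valued function. -/
theorem isWeightedComp_mul {α : Measure X} {t : X → K →L[ℂ] K'} (ht : OpMeasurable t) (C : ℝ≥0)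
    (hC : ∀ x, ‖t x‖ ≤ C) : IsWeightedComp α α id t where
  quasi := Measure.QuasiMeasurePreserving.id α
  meas := ht
  bound := ⟨C, fun f _ => by
    have := eLpNorm_le_nnreal_smul_eLpNorm_of_ae_le_mul (p := 2) (μ := α) (c := C)
      (f := fun y => t y (f y)) (g := f) (ae_of_all _ fun x =>
        ((t x).le_opNorm (f x)).trans (mul_le_mul_of_nonneg_right (hC x) (norm_nonneg _)))
    simpa [ENNReal.smul_def] using this⟩

/-- The norm identity behind weighted composition operators with isometric values. -/
theorem eLpNorm_weighted {α : Measure X} {β : Measure Y} {θ : Y → X} (hθ : Measurable θ)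
    {ρ : Y → ℝ≥0∞} (hρ : Measurable ρ) (hρ_lt : ∀ᵐ y ∂β, ρ y < ∞)
    (hmap : (β.withDensity ρ).map θ = α) {u : Y → K →L[ℂ] K'} (hu : ∀ y v, ‖u y v‖ = ‖v‖)
    {f : X → K} (hf : AEStronglyMeasurable f α) :
    eLpNorm (fun y => (((Real.sqrt (ρ y).toReal : ℝ) : ℂ) • u y) (f (θ y))) 2 β
      = eLpNorm f 2 α := by
  rw [eLpNorm_eq_lintegral_rpow_enorm_toReal (by norm_num) (by norm_num),
    eLpNorm_eq_lintegral_rpow_enorm_toReal (by norm_num) (by norm_num)]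
  congr 1
  have hf' : AEMeasurable (fun x => ‖f x‖ₑ ^ (2 : ℝ≥0∞).toReal) α := by
    exact (hf.enorm).pow_const _
  -- With α written as the image of ρβ under θ, the right side becomes the β-integral of ρ(y) ‖f(θ
  -- y)‖², and ρ is the square of the scalar weight on the left.
  rw [← hmap] at hf' ⊢
  rw [lintegral_map' hf' hθ.aemeasurable,
    lintegral_withDensity_eq_lintegral_mul_non_measurable₀ _ hρ.aemeasurable hρ_lt]
  refine lintegral_congr_ae ?_
  filter_upwards [hρ_lt] with y hy
  simp only [Pi.mul_apply, smul_apply, enorm_smul, ENNReal.toReal_ofNat]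
  rw [ENNReal.mul_rpow_of_nonneg _ _ (by norm_num)]
  congr 1
  · rw [← ofReal_norm, Complex.norm_real, Real.norm_of_nonneg (Real.sqrt_nonneg _),
      ENNReal.ofReal_rpow_of_nonneg (Real.sqrt_nonneg _) (by norm_num), Real.rpow_two,
      Real.sq_sqrt ENNReal.toReal_nonneg, ENNReal.ofReal_toReal hy.ne]
  · rw [← ofReal_norm, hu, ofReal_norm]

theorem isWeightedComp_weighted {α : Measure X} {β : Measure Y} {θ : Y → X}
    (hθ : Measure.QuasiMeasurePreserving θ β α)
    {ρ : Y → ℝ≥0∞} (hρ : Measurable ρ) (hρ_lt : ∀ᵐ y ∂β, ρ y < ∞)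
    (hmap : (β.withDensity ρ).map θ = α) {u : Y → K →L[ℂ] K'} (hu : ∀ y v, ‖u y v‖ = ‖v‖)
    (hum : OpMeasurable u) :
    IsWeightedComp α β θ fun y => ((Real.sqrt (ρ y).toReal : ℝ) : ℂ) • u y where
  quasi := hθ
  meas := hum.smul (by fun_prop)
  bound := ⟨1, fun f hf => by
    rw [eLpNorm_weighted hθ.measurable hρ hρ_lt hmap hu hf]
    simp⟩

end WeightedComposition

/-! ### The invariant measure class of the homogeneous space -/

section HomogeneousSpace

variable {G : Type*} [Group G] [MeasurableSpace G] {m : Multiplier G}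

instance QuotientGroup.instMeasurableConstSMul [MeasurableMul G] (G₀ : Subgroup G) :
    MeasurableConstSMul G (G ⧸ G₀) where
  measurable_const_smul g := by
    refine QuotientGroup.measurable_from_quotient.2 ?_
    exact QuotientGroup.measurable_coe.comp (measurable_const_mul g)

variable [TopologicalSpace G] [IsTopologicalGroup G] [LocallyCompactSpace G]
  [SecondCountableTopology G] [BorelSpace G] {G₀ : Subgroup G}

/-- A finite measure in the invariant measure class of `G ⧸ G₀`. -/
noncomputable def canonicalMeasure (G₀ : Subgroup G) : Measure (G ⧸ G₀) :=
  ((Measure.haar : Measure G).toFinite).map (fun g : G => (g : G ⧸ G₀))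

instance : IsFiniteMeasure (canonicalMeasure G₀) := by
  unfold canonicalMeasure; infer_instance

theorem canonicalMeasure_inInvariantClass :
    InInvariantClass (canonicalMeasure G₀) := by
  refine ⟨inferInstance, fun A hA => ?_⟩
  rw [canonicalMeasure, Measure.map_apply QuotientGroup.measurable_coe hA]
  exact ⟨fun h => absolutelyContinuous_toFinite _ h, fun h => toFinite_absolutelyContinuous _ h⟩

theorem InInvariantClass.absolutelyContinuous {α β : Measure (G ⧸ G₀)}
    (hα : InInvariantClass α) (hβ : InInvariantClass β) : α ≪ β :=
  Measure.AbsolutelyContinuous.mk fun A hA h => (hα.2 A hA).2 ((hβ.2 A hA).1 h)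

theorem InInvariantClass.ae_coe {α : Measure (G ⧸ G₀)} (hα : InInvariantClass α)
    {p : G ⧸ G₀ → Prop} (h : ∀ᵐ x ∂α, p x) : ∀ᵐ g : G ∂Measure.haar, p (g : G ⧸ G₀) := by
  rw [ae_iff] at h
  have h1 := measure_toMeasurable (μ := α) {x | ¬ p x}
  rw [h, hα.2 _ (measurableSet_toMeasurable _ _)] at h1
  exact measure_mono_null (fun g hg => subset_toMeasurable α _ hg) h1

theorem InInvariantClass.ae_of_coe {α : Measure (G ⧸ G₀)} (hα : InInvariantClass α)
    {p : G ⧸ G₀ → Prop} (hp : MeasurableSet {x | p x})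
    (h : ∀ᵐ g : G ∂Measure.haar, p (g : G ⧸ G₀)) : ∀ᵐ x ∂α, p x :=
  (hα.2 _ hp.compl).2 h

theorem InInvariantClass.quasiMeasurePreserving {α : Measure (G ⧸ G₀)} (hα : InInvariantClass α)
    (g : G) : Measure.QuasiMeasurePreserving (fun x : G ⧸ G₀ => g • x) α α := by
  refine ⟨measurable_const_smul g, Measure.AbsolutelyContinuous.mk fun A hA h => ?_⟩
  rw [Measure.map_apply (measurable_const_smul g) hA, hα.2 _ (measurable_const_smul g hA)]
  rw [hα.2 A hA] at h
  have := measure_preimage_mul (Measure.haar : Measure G) g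
    ((fun g : G => (g : G ⧸ G₀)) ⁻¹' A)
  rw [h] at this
  exact this

theorem InInvariantClass.absolutelyContinuous_map {α : Measure (G ⧸ G₀)}
    (hα : InInvariantClass α) (g : G) : α ≪ α.map (fun x => g • x) := by
  refine Measure.AbsolutelyContinuous.mk fun A hA h => ?_
  rw [Measure.map_apply (measurable_const_smul g) hA] at h
  have := (hα.quasiMeasurePreserving g⁻¹).preimage_null h
  rwa [← Set.preimage_comp, show ((fun x : G ⧸ G₀ => g • x) ∘ fun x => g⁻¹ • x) = id by
    funext x; simp] at this

theorem InInvariantClass.neZero {α : Measure (G ⧸ G₀)} (hα : InInvariantClass α) : NeZero α := by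
  refine ⟨fun h => ?_⟩
  have h1 := (hα.2 Set.univ MeasurableSet.univ).1 (by simp [h])
  exact (NeZero.ne (Measure.haar : Measure G)) (by simpa using h1)

theorem sigmaFinite_map_smul (α : Measure (G ⧸ G₀)) [SigmaFinite α] (g : G) :
    SigmaFinite (α.map (fun x => g • x)) :=
  (MeasurableEquiv.smul g).sigmaFinite_map

end HomogeneousSpace

/-! ### Cocycle operators and change of measure -/

section CocycleOperator

variable {G : Type*} [Group G] [TopologicalSpace G] [IsTopologicalGroup G] [LocallyCompactSpace G]
  [SecondCountableTopology G] [MeasurableSpace G] [BorelSpace G] {G₀ : Subgroup G}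
  {m : Multiplier G}
  {K K' : Type*} [NormedAddCommGroup K] [InnerProductSpace ℂ K] [CompleteSpace K]
  [TopologicalSpace.SeparableSpace K] [NormedAddCommGroup K'] [InnerProductSpace ℂ K']
  [CompleteSpace K'] [TopologicalSpace.SeparableSpace K']

theorem map_withDensity_comp {X Y : Type*} [MeasurableSpace X] [MeasurableSpace Y] (α : Measure Y)
    {θ : Y → X} (hθ : Measurable θ) {r : X → ℝ≥0∞} (hr : Measurable r) :
    (α.withDensity fun y => r (θ y)).map θ = (α.map θ).withDensity r := by
  ext s hs
  rw [Measure.map_apply hθ hs, withDensity_apply _ (hθ hs), withDensity_apply _ hs,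
    setLIntegral_map hs hr hθ]

/-- The value of a strict cocycle as a bounded operator. -/
noncomputable def StrictCocycle.toCLM {X : Type*} [MeasurableSpace X] [MulAction G X]
    (φ : StrictCocycle m X K) (g : G) (x : X) : K →L[ℂ] K :=
  ((φ.f g x).toContinuousLinearEquiv : K →L[ℂ] K)

theorem StrictCocycle.toCLM_apply {X : Type*} [MeasurableSpace X] [MulAction G X]
    (φ : StrictCocycle m X K) (g : G) (x : X) (v : K) : φ.toCLM g x v = φ.f g x v := rfl

theorem StrictCocycle.opMeasurable {X : Type*} [MeasurableSpace X] [MulAction G X]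
    (φ : StrictCocycle m X K) : OpMeasurable fun p : G × X => φ.toCLM p.1 p.2 :=
  OpMeasurable.of_inner φ.measurable_inner

/-- The squared weight is r_g ∘ g⁻¹, and the image of (r_g ∘ g⁻¹)α under g⁻¹ is r_g times the image
of α, that is, α itself. So the norm is preserved. -/
theorem isWeightedComp_cocycle {α : Measure (G ⧸ G₀)} (hα : InInvariantClass α)
    (φ : StrictCocycle m (G ⧸ G₀) K) (g : G) :
    IsWeightedComp α α (fun x => g⁻¹ • x) fun x =>
      ((Real.sqrt (radonNikodym α g (g⁻¹ • x)) : ℝ) : ℂ) • φ.toCLM g (g⁻¹ • x) := by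
  have := hα.1
  have := sigmaFinite_map_smul α g⁻¹
  have hm : Measurable fun x : G ⧸ G₀ => g⁻¹ • x := measurable_const_smul _
  refine isWeightedComp_weighted (α := α) (β := α) (θ := fun x => g⁻¹ • x)
    (ρ := fun x => α.rnDeriv (α.map (fun y => g⁻¹ • y)) (g⁻¹ • x))
    (hα.quasiMeasurePreserving g⁻¹) ((Measure.measurable_rnDeriv _ _).comp hm) ?_ ?_
    (fun y v => (φ.f g (g⁻¹ • y)).norm_map v) ?_
  · exact ae_of_ae_map hm.aemeasurable (Measure.rnDeriv_lt_top α (α.map (fun y => g⁻¹ • y)))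
  · rw [map_withDensity_comp α hm (Measure.measurable_rnDeriv _ _),
      Measure.withDensity_rnDeriv_eq _ _ (hα.absolutelyContinuous_map g⁻¹)]
  · exact φ.opMeasurable.comp_measurable (θ := fun x => (g, g⁻¹ • x)) (by fun_prop)

/-- The operator `f ↦ r_g(g⁻¹ x)^{1/2} φ(g, g⁻¹ x) f(g⁻¹ x)`. -/
noncomputable def cocycleOp {α : Measure (G ⧸ G₀)} (hα : InInvariantClass α)
    (φ : StrictCocycle m (G ⧸ G₀) K) (g : G) : Lp K 2 α →L[ℂ] Lp K 2 α :=
  (isWeightedComp_cocycle hα φ g).op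

theorem coeFn_cocycleOp {α : Measure (G ⧸ G₀)} (hα : InInvariantClass α)
    (φ : StrictCocycle m (G ⧸ G₀) K) (g : G) (F : Lp K 2 α) :
    cocycleOp hα φ g F =ᵐ[α] fun x =>
      ((Real.sqrt (radonNikodym α g (g⁻¹ • x)) : ℝ) : ℂ) • φ.f g (g⁻¹ • x) (F (g⁻¹ • x)) :=
  (isWeightedComp_cocycle hα φ g).coeFn_op F

/-- The change of measure `f ↦ (dα/dβ)^{1/2} f` inside the invariant measure class is a weighted
composition operator. -/
theorem isWeightedComp_rescale {α β : Measure (G ⧸ G₀)} (hα : InInvariantClass α)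
    (hβ : InInvariantClass β) :
    IsWeightedComp α β id fun x =>
      ((Real.sqrt (α.rnDeriv β x).toReal : ℝ) : ℂ) • ContinuousLinearMap.id ℂ K := by
  have := hα.1
  have := hβ.1
  refine isWeightedComp_weighted (θ := id) ⟨measurable_id, ?_⟩ (Measure.measurable_rnDeriv _ _)
    (Measure.rnDeriv_lt_top _ _) ?_ (fun y v => rfl) (OpMeasurable.const _)
  · rw [Measure.map_id]
    exact hβ.absolutelyContinuous hα
  · rw [Measure.map_id, Measure.withDensity_rnDeriv_eq _ _ (hα.absolutelyContinuous hβ)]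

/-- The change of measure as a bounded operator. -/
noncomputable def rescaleOp (K : Type*) [NormedAddCommGroup K] [InnerProductSpace ℂ K]
    [CompleteSpace K] [TopologicalSpace.SeparableSpace K] {α β : Measure (G ⧸ G₀)}
    (hα : InInvariantClass α) (hβ : InInvariantClass β) : Lp K 2 α →L[ℂ] Lp K 2 β :=
  (isWeightedComp_rescale hα hβ).op

theorem coeFn_rescaleOp {α β : Measure (G ⧸ G₀)} (hα : InInvariantClass α)
    (hβ : InInvariantClass β) (F : Lp K 2 α) :
    rescaleOp K hα hβ F =ᵐ[β] fun x =>
      ((Real.sqrt (α.rnDeriv β x).toReal : ℝ) : ℂ) • F x :=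
  (isWeightedComp_rescale hα hβ).coeFn_op F

theorem norm_rescaleOp {α β : Measure (G ⧸ G₀)} (hα : InInvariantClass α)
    (hβ : InInvariantClass β) (F : Lp K 2 α) : ‖rescaleOp K hα hβ F‖ = ‖F‖ := by
  have := hα.1
  have := hβ.1
  rw [Lp.norm_def, Lp.norm_def, eLpNorm_congr_ae (coeFn_rescaleOp hα hβ F)]
  congr 1
  refine eLpNorm_weighted (θ := id) (u := fun _ => ContinuousLinearMap.id ℂ K) measurable_id
    (Measure.measurable_rnDeriv α β) (Measure.rnDeriv_lt_top _ _) ?_ (fun y v => rfl)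
    (Lp.aestronglyMeasurable F)
  rw [Measure.map_id, Measure.withDensity_rnDeriv_eq _ _ (hα.absolutelyContinuous hβ)]

theorem rescaleOp_rescaleOp {α β : Measure (G ⧸ G₀)} (hα : InInvariantClass α)
    (hβ : InInvariantClass β) (F : Lp K 2 β) :
    rescaleOp K hα hβ (rescaleOp K hβ hα F) = F := by
  have := hα.1
  have := hβ.1
  apply Lp.ext
  have h := Measure.rnDeriv_mul_rnDeriv (κ := β) (hα.absolutelyContinuous hβ) (μ := α) (ν := β)
  filter_upwards [coeFn_rescaleOp hα hβ (rescaleOp K hβ hα F),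
    hβ.absolutelyContinuous hα (coeFn_rescaleOp hβ hα F),
    hβ.absolutelyContinuous hα (Measure.inv_rnDeriv (hα.absolutelyContinuous hβ)),
    Measure.rnDeriv_lt_top α β,
    hβ.absolutelyContinuous hα (Measure.rnDeriv_pos (hα.absolutelyContinuous hβ))]
    with x h1 h2 h3 h4 h5
  rw [h1, h2, smul_smul, ← h3, ← Complex.ofReal_mul, ← Real.sqrt_mul ENNReal.toReal_nonneg,
    Pi.inv_apply, ← ENNReal.toReal_mul, ENNReal.mul_inv_cancel h5.ne' h4.ne]
  simp

/-- The change of measure as a unitary operator. -/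
noncomputable def rescale (K : Type*) [NormedAddCommGroup K] [InnerProductSpace ℂ K]
    [CompleteSpace K]
    [TopologicalSpace.SeparableSpace K] {α β : Measure (G ⧸ G₀)}
    (hα : InInvariantClass α) (hβ : InInvariantClass β) : Lp K 2 α ≃ₗᵢ[ℂ] Lp K 2 β :=
  LinearIsometryEquiv.ofSurjective
    { toLinearMap := (rescaleOp K hα hβ).toLinearMap
      norm_map' := norm_rescaleOp hα hβ }
    fun F => ⟨rescaleOp K hβ hα F, rescaleOp_rescaleOp hα hβ F⟩

theorem rescale_apply {α β : Measure (G ⧸ G₀)} (hα : InInvariantClass α)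
    (hβ : InInvariantClass β) (F : Lp K 2 α) : rescale K hα hβ F = rescaleOp K hα hβ F := rfl

/-- The chain rule for the Radon-Nikodym cocycles of two measures in the invariant class. -/
theorem radonNikodym_chain {α β : Measure (G ⧸ G₀)} (hα : InInvariantClass α)
    (hβ : InInvariantClass β) (g : G) :
    ∀ᵐ x ∂β, (α.rnDeriv β x).toReal * radonNikodym α g (g⁻¹ • x) =
      radonNikodym β g (g⁻¹ • x) * (α.rnDeriv β (g⁻¹ • x)).toReal := by
  have := hα.1
  have := hβ.1
  have := sigmaFinite_map_smul α g⁻¹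
  have := sigmaFinite_map_smul β g⁻¹
  have hm : Measurable fun x : G ⧸ G₀ => g⁻¹ • x := measurable_const_smul _
  have hab := hα.absolutelyContinuous hβ
  -- Both sides are the derivative, at g⁻¹x, of α with respect to the image of β under g⁻¹: one
  -- chain passes through the image of α, the other through β.
  have h1 := ae_of_ae_map hm.aemeasurable (Measure.rnDeriv_mul_rnDeriv
    (μ := α) (ν := α.map fun y => g⁻¹ • y) (κ := β.map fun y => g⁻¹ • y)
    (hα.absolutelyContinuous_map g⁻¹))
  have h2 := ae_of_ae_map hm.aemeasurable (Measure.rnDeriv_mul_rnDeriv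
    (μ := α) (ν := β) (κ := β.map fun y => g⁻¹ • y) hab)
  have h3 := (measurableEmbedding_const_smul (α := G ⧸ G₀) g⁻¹).rnDeriv_map α β
  filter_upwards [h1, h2, h3] with x h1 h2 h3
  simp only [Pi.mul_apply] at h1 h2 h3
  rw [h3] at h1
  simp only [radonNikodym]
  rw [← ENNReal.toReal_mul, ← ENNReal.toReal_mul, mul_comm, h1, ← h2, mul_comm]

/-- This is `radonNikodym_chain` under square roots. It allows every system to be realized over one
fixed measure of the class. -/
theorem rescaleOp_cocycleOp {α β : Measure (G ⧸ G₀)} (hα : InInvariantClass α)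
    (hβ : InInvariantClass β) (φ : StrictCocycle m (G ⧸ G₀) K) (g : G) (F : Lp K 2 α) :
    rescaleOp K hα hβ (cocycleOp hα φ g F) = cocycleOp hβ φ g (rescaleOp K hα hβ F) := by
  apply Lp.ext
  filter_upwards [coeFn_rescaleOp hα hβ (cocycleOp hα φ g F),
    hβ.absolutelyContinuous hα (coeFn_cocycleOp hα φ g F),
    coeFn_cocycleOp hβ φ g (rescaleOp K hα hβ F),
    (hβ.quasiMeasurePreserving g⁻¹).ae (coeFn_rescaleOp hα hβ F),
    radonNikodym_chain hα hβ g] with x h1 h2 h3 h4 h5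
  rw [h1, h2, h3, h4, map_smul, smul_smul, smul_smul, ← Complex.ofReal_mul, ← Complex.ofReal_mul,
    ← Real.sqrt_mul ENNReal.toReal_nonneg, h5, Real.sqrt_mul]
  exact ENNReal.toReal_nonneg

end CocycleOperator

/-! ### Realizations over the canonical measure -/

section Model

variable {G : Type*} [Group G] [MeasurableSpace G] {m : Multiplier G}

/-- Transport of a system of imprimitivity along a unitary operator. -/
noncomputable def MSystem.transport {X : Type*} [MeasurableSpace X] [MulAction G X]
    {H H' : Type*} [NormedAddCommGroup H] [InnerProductSpace ℂ H] [CompleteSpace H]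
    [NormedAddCommGroup H'] [InnerProductSpace ℂ H'] [CompleteSpace H']
    (S : MSystem m X H) (W : H ≃ₗᵢ[ℂ] H') : MSystem m X H' where
  U g := (W.symm.trans (S.U g)).trans W
  map_mul g h v := by simp [S.map_mul]
  measurable_inner v w := by
    have h := S.measurable_inner (W.symm v) (W.symm w)
    convert h using 2 with g
    rw [← W.inner_map_map]
    simp
  P E := (W : H →L[ℂ] H') ∘L S.P E ∘L (W.symm : H' →L[ℂ] H)
  isStarProjection E hE := by
    have h := S.isStarProjection E hE
    refine ⟨?_, ?_⟩
    · have h1 := h.isIdempotentElem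
      ext v
      have := DFunLike.congr_fun h1 (W.symm v)
      simp only [mul_apply_eq_comp] at this
      simp [this]
    · rw [ContinuousLinearMap.isSelfAdjoint_iff_isSymmetric]
      have h1 := (ContinuousLinearMap.isSelfAdjoint_iff_isSymmetric.1 h.isSelfAdjoint)
      intro v w
      have h2 := h1 (W.symm v) (W.symm w)
      simp only [ContinuousLinearMap.coe_coe] at h2
      simp only [ContinuousLinearMap.coe_coe, ContinuousLinearMap.comp_apply,
        LinearIsometryEquiv.coe_coe'']
      rw [← W.symm.inner_map_map, ← W.symm.inner_map_map v]
      simpa using h2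
  univ := by
    ext v
    simp [S.univ]
  inter E F hE hF := by
    ext v
    simp [S.inter E F hE hF]
  hasSum_iUnion E hE hd v := by
    have := S.hasSum_iUnion E hE hd (W.symm v)
    exact (W : H →L[ℂ] H').hasSum this
  covariant g E hE v := by
    have h := S.covariant g E hE (W.symm v)
    simp only [LinearIsometryEquiv.trans_apply, LinearIsometryEquiv.symm_trans,
      LinearIsometryEquiv.symm_symm, ContinuousLinearMap.comp_apply,
      LinearIsometryEquiv.coe_coe'', LinearIsometryEquiv.symm_apply_apply]
    rw [h]

variable [TopologicalSpace G] [IsTopologicalGroup G] [LocallyCompactSpace G]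
  [SecondCountableTopology G] [BorelSpace G] {G₀ : Subgroup G}
  {K H : Type*} [NormedAddCommGroup K] [InnerProductSpace ℂ K] [CompleteSpace K]
  [TopologicalSpace.SeparableSpace K] [NormedAddCommGroup H] [InnerProductSpace ℂ H]
  [CompleteSpace H]

/-- A realization of a system of imprimitivity by a strict cocycle, with respect to the
canonical measure. -/
structure IsModel (D : MRep (m.restrict G₀) K) (S : MSystem m (G ⧸ G₀) H)
    (φ : StrictCocycle m (G ⧸ G₀) K) (W : H ≃ₗᵢ[ℂ] Lp K 2 (canonicalMeasure G₀)) : Prop where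
  base : ∀ h : G₀, φ.f (h : G) ((1 : G) : G ⧸ G₀) = D.U h
  proj : ∀ E, MeasurableSet E → ∀ v, W (S.P E v) =ᵐ[canonicalMeasure G₀] E.indicator (W v)
  unit : ∀ᵐ g ∂(Measure.haar : Measure G), ∀ v,
    W (S.U g v) = cocycleOp canonicalMeasure_inInvariantClass φ g (W v)

/-- Rescaling removes the choice of measure, so that systems associated to different representations
can be compared fibrewise over the same measure space. In the other direction the system required on
L² is the transport of `S` along W. -/
theorem isAssociated_iff_exists_isModel (D : MRep (m.restrict G₀) K)
    (S : MSystem m (G ⧸ G₀) H) : IsAssociated D S ↔ ∃ φ W, IsModel D S φ W := by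
  have hc := canonicalMeasure_inInvariantClass (G := G) (G₀ := G₀)
  constructor
  · rintro ⟨α, hα, φ, hφ, S', ⟨hP, hU⟩, W, hWU, hWP⟩
    refine ⟨φ, W.trans (rescale K hα hc), hφ, fun E hE v => ?_, ?_⟩
    · simp only [LinearIsometryEquiv.trans_apply, rescale_apply, hWP E hE]
      filter_upwards [coeFn_rescaleOp hα hc (S'.P E (W v)), coeFn_rescaleOp hα hc (W v),
        hc.absolutelyContinuous hα (hP E hE (W v))] with x h1 h2 h3
      rw [h1, h3]
      by_cases hx : x ∈ E
      · simp [hx, h2]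
      · simp [hx]
    · filter_upwards [hU] with g hg v
      simp only [LinearIsometryEquiv.trans_apply, rescale_apply, hWU]
      rw [← rescaleOp_cocycleOp]
      congr 1
      exact Lp.ext ((hg (W v)).trans (coeFn_cocycleOp hα φ g (W v)).symm)
  · rintro ⟨φ, W, h⟩
    refine ⟨canonicalMeasure G₀, hc, φ, h.base, S.transport W, ⟨fun E hE F => ?_, ?_⟩, W,
      fun g v => ?_, fun E hE v => ?_⟩
    · simpa [MSystem.transport] using h.proj E hE (W.symm F)
    · filter_upwards [h.unit] with g hg F
      have h1 := hg (W.symm F)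
      rw [W.apply_symm_apply] at h1
      have h2 : (S.transport W).U g F = cocycleOp hc φ g F := h1
      rw [h2]
      exact coeFn_cocycleOp hc φ g F
    · simp [MSystem.transport]
    · simp [MSystem.transport]

end Model

/-- Bounded intertwining operators between two `m`-representations. -/
def IsIntertwiner {G : Type*} [Group G] [MeasurableSpace G] {m : Multiplier G}
    {K K' : Type*} [NormedAddCommGroup K] [InnerProductSpace ℂ K]
    [NormedAddCommGroup K'] [InnerProductSpace ℂ K'] (D : MRep m K) (D' : MRep m K')
    (T : K →L[ℂ] K') : Prop :=
  ∀ g v, T (D.U g v) = D'.U g (T v)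

/-! ### From intertwiners of representations to decomposable operators -/

section InducedOperator

variable {G : Type*} [Group G] [TopologicalSpace G] [IsTopologicalGroup G] [LocallyCompactSpace G]
  [SecondCountableTopology G] [MeasurableSpace G] [BorelSpace G] {G₀ : Subgroup G}
  {m : Multiplier G}
  {K K' K'' : Type*} [NormedAddCommGroup K] [InnerProductSpace ℂ K] [CompleteSpace K]
  [TopologicalSpace.SeparableSpace K] [NormedAddCommGroup K'] [InnerProductSpace ℂ K']
  [CompleteSpace K'] [TopologicalSpace.SeparableSpace K']
  [NormedAddCommGroup K''] [InnerProductSpace ℂ K'']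
  [CompleteSpace K''] [TopologicalSpace.SeparableSpace K'']

/-- The strict cocycle `φ` defines the representation `D` at the base point. -/
abbrev StrictCocycle.Defines (φ : StrictCocycle m (G ⧸ G₀) K) (D : MRep (m.restrict G₀) K) :
    Prop :=
  ∀ h : G₀, φ.f (h : G) ((1 : G) : G ⧸ G₀) = D.U h

/-- The operator `φ'(g, x₀) T φ(g, x₀)⁻¹`, where `x₀` is the base point. -/
noncomputable def conjOp (φ : StrictCocycle m (G ⧸ G₀) K) (φ' : StrictCocycle m (G ⧸ G₀) K')
    (T : K →L[ℂ] K') (g : G) : K →L[ℂ] K' :=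
  φ'.toCLM g ((1 : G) : G ⧸ G₀) ∘L T ∘L
    ((φ.f g ((1 : G) : G ⧸ G₀)).symm.toContinuousLinearEquiv : K →L[ℂ] K)

theorem conjOp_apply (φ : StrictCocycle m (G ⧸ G₀) K) (φ' : StrictCocycle m (G ⧸ G₀) K')
    (T : K →L[ℂ] K') (g : G) (v : K) : conjOp φ φ' T g v =
      φ'.f g ((1 : G) : G ⧸ G₀) (T ((φ.f g ((1 : G) : G ⧸ G₀)).symm v)) := rfl

theorem adjoint_toCLM (φ : StrictCocycle m (G ⧸ G₀) K) (g : G) (x : G ⧸ G₀) :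
    ContinuousLinearMap.adjoint (φ.toCLM g x) =
      ((φ.f g x).symm.toContinuousLinearEquiv : K →L[ℂ] K) := by
  symm
  rw [ContinuousLinearMap.eq_adjoint_iff]
  intro v w
  rw [← (φ.f g x).inner_map_map]
  simp [StrictCocycle.toCLM_apply]

theorem smul_base (g : G) : g • ((1 : G) : G ⧸ G₀) = (g : G ⧸ G₀) := by
  rw [MulAction.Quotient.smul_coe, smul_eq_mul, mul_one]

theorem cocycle_base (φ : StrictCocycle m (G ⧸ G₀) K) (g a : G) (v : K) :
    φ.f (g * a) ((1 : G) : G ⧸ G₀) v =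
      (m g a : ℂ) • φ.f g (a : G ⧸ G₀) (φ.f a ((1 : G) : G ⧸ G₀) v) := by
  rw [φ.map_mul, smul_base]

/-- Expand φ(ga, x₀) and φ'(ga, x₀) by the cocycle identity: the same scalar m(g, a) occurs in both
and cancels. -/
theorem conjOp_mul_comp (φ : StrictCocycle m (G ⧸ G₀) K) (φ' : StrictCocycle m (G ⧸ G₀) K')
    (T : K →L[ℂ] K') (g a : G) :
    conjOp φ φ' T (g * a) ∘L φ.toCLM g (a : G ⧸ G₀) =
      φ'.toCLM g (a : G ⧸ G₀) ∘L conjOp φ φ' T a := by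
  ext w
  obtain ⟨u, rfl⟩ := (φ.f a ((1 : G) : G ⧸ G₀)).surjective w
  have hm : (m g a : ℂ) ≠ 0 := Circle.coe_ne_zero _
  apply smul_right_injective _ hm
  simp only [ContinuousLinearMap.comp_apply, StrictCocycle.toCLM_apply, conjOp_apply,
    LinearIsometryEquiv.symm_apply_apply]
  rw [← cocycle_base, ← map_smul, ← map_smul, ← map_smul, ← cocycle_base,
    LinearIsometryEquiv.symm_apply_apply]

theorem opMeasurable_conjOp (φ : StrictCocycle m (G ⧸ G₀) K) (φ' : StrictCocycle m (G ⧸ G₀) K')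
    (T : K →L[ℂ] K') : OpMeasurable (conjOp φ φ' T) := by
  have h1 : OpMeasurable fun g => φ.toCLM g ((1 : G) : G ⧸ G₀) :=
    φ.opMeasurable.comp_measurable (θ := fun g => (g, ((1 : G) : G ⧸ G₀))) (by fun_prop)
  have h2 : OpMeasurable fun g => φ'.toCLM g ((1 : G) : G ⧸ G₀) :=
    φ'.opMeasurable.comp_measurable (θ := fun g => (g, ((1 : G) : G ⧸ G₀))) (by fun_prop)
  have h3 := h1.adjoint
  simp only [adjoint_toCLM] at h3
  exact h2.comp ((OpMeasurable.const T).comp h3)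

/-- At h ∈ `G₀` the conjugate is D'(h) T D(h)⁻¹ = T, and `conjOp_mul_comp` carries this from the
base point to gx₀. Hence the conjugate descends to cosets. -/
theorem conjOp_mul_coe {D : MRep (m.restrict G₀) K} {D' : MRep (m.restrict G₀) K'}
    {φ : StrictCocycle m (G ⧸ G₀) K} {φ' : StrictCocycle m (G ⧸ G₀) K'}
    (hφ : φ.Defines D) (hφ' : φ'.Defines D') {T : K →L[ℂ] K'} (hT : IsIntertwiner D D' T)
    (g : G) (h : G₀) : conjOp φ φ' T (g * h) = conjOp φ φ' T g := by
  have key := conjOp_mul_comp φ φ' T g h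
  have hx : ((h : G) : G ⧸ G₀) = ((1 : G) : G ⧸ G₀) := by
    rw [QuotientGroup.eq]; simp
  have h1 : conjOp φ φ' T (h : G) = T := by
    ext v
    rw [conjOp_apply, hφ, hφ', ← hT, LinearIsometryEquiv.apply_symm_apply]
  rw [hx, h1] at key
  ext v
  have := DFunLike.congr_fun key ((φ.f g ((1 : G) : G ⧸ G₀)).symm v)
  simpa [StrictCocycle.toCLM_apply, conjOp_apply] using this

/-- The operator field on `G ⧸ G₀` defined by an operator between the fibres at the base point. -/
noncomputable def fieldOp (φ : StrictCocycle m (G ⧸ G₀) K) (φ' : StrictCocycle m (G ⧸ G₀) K')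
    (T : K →L[ℂ] K') (x : G ⧸ G₀) : K →L[ℂ] K' :=
  conjOp φ φ' T (Quotient.out x)

theorem fieldOp_coe {D : MRep (m.restrict G₀) K} {D' : MRep (m.restrict G₀) K'}
    {φ : StrictCocycle m (G ⧸ G₀) K} {φ' : StrictCocycle m (G ⧸ G₀) K'}
    (hφ : φ.Defines D) (hφ' : φ'.Defines D') {T : K →L[ℂ] K'} (hT : IsIntertwiner D D' T)
    (g : G) : fieldOp φ φ' T (g : G ⧸ G₀) = conjOp φ φ' T g := by
  obtain ⟨h, hh⟩ := QuotientGroup.mk_out_eq_mul G₀ g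
  rw [fieldOp, hh, conjOp_mul_coe hφ hφ' hT]

/-- Measurability for the quotient structure is tested after pulling back to G, where the field is
`conjOp`. The representative chosen by `Quotient.out` need not be measurable, so no Borel section is
needed. -/
theorem opMeasurable_fieldOp {D : MRep (m.restrict G₀) K} {D' : MRep (m.restrict G₀) K'}
    {φ : StrictCocycle m (G ⧸ G₀) K} {φ' : StrictCocycle m (G ⧸ G₀) K'}
    (hφ : φ.Defines D) (hφ' : φ'.Defines D') {T : K →L[ℂ] K'} (hT : IsIntertwiner D D' T) :
    OpMeasurable (fieldOp φ φ' T) := by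
  intro v
  borelize K'
  have : SecondCountableTopology K' := UniformSpace.secondCountable_of_separable K'
  refine Measurable.stronglyMeasurable ?_
  refine QuotientGroup.measurable_from_quotient.2 ?_
  have := (opMeasurable_conjOp φ φ' T v).measurable
  convert this using 2 with g
  exact DFunLike.congr_fun (fieldOp_coe hφ hφ' hT g) v

theorem norm_fieldOp_le (φ : StrictCocycle m (G ⧸ G₀) K) (φ' : StrictCocycle m (G ⧸ G₀) K')
    (T : K →L[ℂ] K') (x : G ⧸ G₀) : ‖fieldOp φ φ' T x‖ ≤ ‖T‖ := by
  refine ContinuousLinearMap.opNorm_le_bound _ (norm_nonneg _) fun v => ?_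
  rw [fieldOp, conjOp_apply, LinearIsometryEquiv.norm_map]
  refine (T.le_opNorm _).trans ?_
  rw [LinearIsometryEquiv.norm_map]

theorem fieldOp_smul_comp {D : MRep (m.restrict G₀) K} {D' : MRep (m.restrict G₀) K'}
    {φ : StrictCocycle m (G ⧸ G₀) K} {φ' : StrictCocycle m (G ⧸ G₀) K'}
    (hφ : φ.Defines D) (hφ' : φ'.Defines D') {T : K →L[ℂ] K'} (hT : IsIntertwiner D D' T)
    (g : G) (x : G ⧸ G₀) (v : K) :
    fieldOp φ φ' T (g • x) (φ.f g x v) = φ'.f g x (fieldOp φ φ' T x v) := by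
  obtain ⟨a, rfl⟩ := QuotientGroup.mk_surjective x
  rw [MulAction.Quotient.smul_coe, fieldOp_coe hφ hφ' hT, fieldOp_coe hφ hφ' hT]
  exact DFunLike.congr_fun (conjOp_mul_comp φ φ' T g a) v

theorem fieldOp_comp (φ : StrictCocycle m (G ⧸ G₀) K) (φ' : StrictCocycle m (G ⧸ G₀) K')
    (φ'' : StrictCocycle m (G ⧸ G₀) K'') (T : K →L[ℂ] K') (T' : K' →L[ℂ] K'') (x : G ⧸ G₀)
    (v : K) : fieldOp φ φ'' (T' ∘L T) x v = fieldOp φ' φ'' T' x (fieldOp φ φ' T x v) := by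
  simp [fieldOp, conjOp_apply]

theorem fieldOp_adjoint (φ : StrictCocycle m (G ⧸ G₀) K) (φ' : StrictCocycle m (G ⧸ G₀) K')
    (T : K →L[ℂ] K') (x : G ⧸ G₀) :
    fieldOp φ' φ (ContinuousLinearMap.adjoint T) x =
      ContinuousLinearMap.adjoint (fieldOp φ φ' T x) := by
  rw [ContinuousLinearMap.eq_adjoint_iff]
  intro v w
  rw [fieldOp, fieldOp, conjOp_apply, conjOp_apply]
  set a := φ.f (Quotient.out x) ((1 : G) : G ⧸ G₀)
  set b := φ'.f (Quotient.out x) ((1 : G) : G ⧸ G₀)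
  rw [← a.symm.inner_map_map, ← b.symm.inner_map_map]
  simp [ContinuousLinearMap.adjoint_inner_left]

theorem fieldOp_injective (φ : StrictCocycle m (G ⧸ G₀) K) (φ' : StrictCocycle m (G ⧸ G₀) K')
    {T T' : K →L[ℂ] K'} {x : G ⧸ G₀} (h : fieldOp φ φ' T x = fieldOp φ φ' T' x) : T = T' := by
  ext v
  have := DFunLike.congr_fun h (φ.f (Quotient.out x) ((1 : G) : G ⧸ G₀) v)
  simpa [fieldOp, conjOp_apply] using this

open Classical in
/-- The decomposable operator on `L²(G ⧸ G₀)` defined by an operator between the fibres at the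
base point. -/
noncomputable def inducedOp (φ : StrictCocycle m (G ⧸ G₀) K) (φ' : StrictCocycle m (G ⧸ G₀) K')
    (T : K →L[ℂ] K') :
    Lp K 2 (canonicalMeasure G₀) →L[ℂ] Lp K' 2 (canonicalMeasure G₀) :=
  -- The value 0 never occurs for an intertwiner, whose field is measurable and bounded by ‖T‖. It
  -- only makes the operator defined for every T.
  if h : IsWeightedComp (canonicalMeasure G₀) (canonicalMeasure G₀) id (fieldOp φ φ' T)
  then h.op else 0

variable {D : MRep (m.restrict G₀) K} {D' : MRep (m.restrict G₀) K'}
  {D'' : MRep (m.restrict G₀) K''}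
  {φ : StrictCocycle m (G ⧸ G₀) K} {φ' : StrictCocycle m (G ⧸ G₀) K'}
  {φ'' : StrictCocycle m (G ⧸ G₀) K''}

theorem coeFn_inducedOp (hφ : φ.Defines D) (hφ' : φ'.Defines D') {T : K →L[ℂ] K'}
    (hT : IsIntertwiner D D' T) (F : Lp K 2 (canonicalMeasure G₀)) :
    inducedOp φ φ' T F =ᵐ[canonicalMeasure G₀] fun x => fieldOp φ φ' T x (F x) := by
  have h : IsWeightedComp (canonicalMeasure G₀) (canonicalMeasure G₀) id (fieldOp φ φ' T) :=
    isWeightedComp_mul (opMeasurable_fieldOp hφ hφ' hT) ‖T‖₊ (norm_fieldOp_le φ φ' T)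
  rw [inducedOp, dif_pos h]
  exact h.coeFn_op F

namespace IsIntertwiner

theorem comp {T : K →L[ℂ] K'} {T' : K' →L[ℂ] K''} (hT' : IsIntertwiner D' D'' T')
    (hT : IsIntertwiner D D' T) : IsIntertwiner D D'' (T' ∘L T) := fun g v => by
  rw [ContinuousLinearMap.comp_apply, hT, hT', ContinuousLinearMap.comp_apply]

theorem id : IsIntertwiner D D (ContinuousLinearMap.id ℂ K) := fun _ _ => rfl

theorem zero : IsIntertwiner D D' 0 := fun g v => by simp

theorem adjoint {T : K →L[ℂ] K'} (hT : IsIntertwiner D D' T) :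
    IsIntertwiner D' D (ContinuousLinearMap.adjoint T) := fun g v => by
  refine ext_inner_right ℂ fun w => ?_
  rw [ContinuousLinearMap.adjoint_inner_left]
  obtain ⟨u, rfl⟩ := (D.U g).surjective w
  rw [hT, LinearIsometryEquiv.inner_map_map, LinearIsometryEquiv.inner_map_map,
    ContinuousLinearMap.adjoint_inner_left]

end IsIntertwiner

theorem inducedOp_comp (hφ : φ.Defines D) (hφ' : φ'.Defines D') (hφ'' : φ''.Defines D'')
    {T : K →L[ℂ] K'} {T' : K' →L[ℂ] K''} (hT : IsIntertwiner D D' T)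
    (hT' : IsIntertwiner D' D'' T') :
    inducedOp φ φ'' (T' ∘L T) = inducedOp φ' φ'' T' ∘L inducedOp φ φ' T := by
  ext1 F
  apply Lp.ext
  filter_upwards [coeFn_inducedOp hφ hφ'' (hT'.comp hT) F,
    coeFn_inducedOp hφ' hφ'' hT' (inducedOp φ φ' T F), coeFn_inducedOp hφ hφ' hT F]
    with x h1 h2 h3
  rw [h1, ContinuousLinearMap.comp_apply, h2, h3, fieldOp_comp φ φ' φ'']

theorem inducedOp_id (hφ : φ.Defines D) :
    inducedOp φ φ (ContinuousLinearMap.id ℂ K) = ContinuousLinearMap.id ℂ _ := by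
  ext1 F
  apply Lp.ext
  filter_upwards [coeFn_inducedOp hφ hφ IsIntertwiner.id F] with x h1
  rw [h1]
  simp [fieldOp, conjOp_apply]

theorem inducedOp_add (hφ : φ.Defines D) (hφ' : φ'.Defines D') {T T' : K →L[ℂ] K'}
    (hT : IsIntertwiner D D' T) (hT' : IsIntertwiner D D' T') :
    inducedOp φ φ' (T + T') = inducedOp φ φ' T + inducedOp φ φ' T' := by
  ext1 F
  apply Lp.ext
  have h : IsIntertwiner D D' (T + T') := fun g v => by
    rw [add_apply, add_apply, hT, hT', map_add]
  rw [add_apply]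
  filter_upwards [coeFn_inducedOp hφ hφ' h F, coeFn_inducedOp hφ hφ' hT F,
    coeFn_inducedOp hφ hφ' hT' F, Lp.coeFn_add (inducedOp φ φ' T F) (inducedOp φ φ' T' F)]
    with x h1 h2 h3 h4
  rw [h4, Pi.add_apply, h1, h2, h3]
  simp [fieldOp, conjOp_apply]

theorem inducedOp_smul (hφ : φ.Defines D) (hφ' : φ'.Defines D') (c : ℂ) {T : K →L[ℂ] K'}
    (hT : IsIntertwiner D D' T) :
    inducedOp φ φ' (c • T) = c • inducedOp φ φ' T := by
  ext1 F
  apply Lp.ext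
  have h : IsIntertwiner D D' (c • T) := fun g v => by
    rw [smul_apply, smul_apply, hT, map_smul]
  rw [smul_apply]
  filter_upwards [coeFn_inducedOp hφ hφ' h F, coeFn_inducedOp hφ hφ' hT F,
    Lp.coeFn_smul c (inducedOp φ φ' T F)] with x h1 h2 h4
  rw [h4, Pi.smul_apply, h1, h2]
  simp [fieldOp, conjOp_apply]

theorem inducedOp_adjoint (hφ : φ.Defines D) (hφ' : φ'.Defines D') {T : K →L[ℂ] K'}
    (hT : IsIntertwiner D D' T) :
    inducedOp φ' φ (ContinuousLinearMap.adjoint T) =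
      ContinuousLinearMap.adjoint (inducedOp φ φ' T) := by
  rw [ContinuousLinearMap.eq_adjoint_iff]
  intro F F'
  rw [L2.inner_def, L2.inner_def]
  refine integral_congr_ae ?_
  filter_upwards [coeFn_inducedOp hφ' hφ hT.adjoint F, coeFn_inducedOp hφ hφ' hT F']
    with x h1 h2
  rw [h1, h2, fieldOp_adjoint, ContinuousLinearMap.adjoint_inner_left]

/-- The measure is finite, so constant functions lie in L². Testing on a dense sequence of constants
shows that the fields agree almost everywhere, and agreement at a single point already determines T
by unitary conjugation. -/
theorem inducedOp_injective (hφ : φ.Defines D) (hφ' : φ'.Defines D') {T T' : K →L[ℂ] K'}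
    (hT : IsIntertwiner D D' T) (hT' : IsIntertwiner D D' T')
    (h : inducedOp φ φ' T = inducedOp φ φ' T') : T = T' := by
  have key : ∀ᵐ x ∂canonicalMeasure G₀, ∀ n,
      fieldOp φ φ' T x (TopologicalSpace.denseSeq K n) =
        fieldOp φ φ' T' x (TopologicalSpace.denseSeq K n) := by
    rw [ae_all_iff]
    intro n
    set c := Lp.const 2 (canonicalMeasure G₀) (TopologicalSpace.denseSeq K n) with hc
    filter_upwards [coeFn_inducedOp hφ hφ' hT c, coeFn_inducedOp hφ hφ' hT' c,
      Lp.coeFn_const 2 (canonicalMeasure G₀) (TopologicalSpace.denseSeq K n)] with x h1 h2 h3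
    rw [← hc] at h3
    rw [h, h2, h3] at h1
    exact h1.symm
  have := (canonicalMeasure_inInvariantClass (G₀ := G₀)).neZero
  obtain ⟨x, hx⟩ := key.exists
  exact fieldOp_injective φ φ' (ContinuousLinearMap.ext_denseSeq hx)

theorem inducedOp_indicator (hφ : φ.Defines D) (hφ' : φ'.Defines D') {T : K →L[ℂ] K'}
    (hT : IsIntertwiner D D' T) {E : Set (G ⧸ G₀)} {F F' : Lp K 2 (canonicalMeasure G₀)}
    (h : F' =ᵐ[canonicalMeasure G₀] E.indicator F) :
    inducedOp φ φ' T F' =ᵐ[canonicalMeasure G₀] E.indicator (inducedOp φ φ' T F) := by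
  filter_upwards [coeFn_inducedOp hφ hφ' hT F, coeFn_inducedOp hφ hφ' hT F', h] with x h1 h2 h3
  rw [h2, h3]
  by_cases hx : x ∈ E
  · simp [hx, h1]
  · simp [hx]

theorem inducedOp_cocycleOp (hφ : φ.Defines D) (hφ' : φ'.Defines D') {T : K →L[ℂ] K'}
    (hT : IsIntertwiner D D' T) (g : G) (F : Lp K 2 (canonicalMeasure G₀)) :
    inducedOp φ φ' T (cocycleOp canonicalMeasure_inInvariantClass φ g F) =
      cocycleOp canonicalMeasure_inInvariantClass φ' g (inducedOp φ φ' T F) := by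
  have hc := canonicalMeasure_inInvariantClass (G₀ := G₀)
  apply Lp.ext
  filter_upwards [coeFn_inducedOp hφ hφ' hT (cocycleOp hc φ g F), coeFn_cocycleOp hc φ g F,
    coeFn_cocycleOp hc φ' g (inducedOp φ φ' T F),
    (hc.quasiMeasurePreserving g⁻¹).ae (coeFn_inducedOp hφ hφ' hT F)] with x h1 h2 h3 h4
  have := fieldOp_smul_comp hφ hφ' hT g (g⁻¹ • x) (F (g⁻¹ • x))
  rw [smul_inv_smul] at this
  rw [h1, h2, h3, h4, map_smul, this]

end InducedOperator

/-! ### Operators commuting with indicator functions are decomposable -/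

section Decomposable

variable {X K K' : Type*} [MeasurableSpace X]
  [NormedAddCommGroup K] [InnerProductSpace ℂ K] [CompleteSpace K]
  [TopologicalSpace.SeparableSpace K] [NormedAddCommGroup K'] [InnerProductSpace ℂ K']
  [CompleteSpace K']

theorem OpMeasurable.of_denseSeq {t : X → K →L[ℂ] K'}
    (h : ∀ n, StronglyMeasurable fun x => t x (TopologicalSpace.denseSeq K n)) :
    OpMeasurable t := by
  intro v
  obtain ⟨u, hu, hlim⟩ := mem_closure_iff_seq_limit.1
    ((TopologicalSpace.denseRange_denseSeq K).closure_range ▸ Set.mem_univ v)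
  choose k hk using hu
  refine stronglyMeasurable_of_tendsto (u := atTop)
    (f := fun n x => t x (TopologicalSpace.denseSeq K (k n))) (fun n => h _) ?_
  rw [tendsto_pi_nhds]
  intro x
  simp only [hk]
  exact ((t x).continuous.tendsto v).comp hlim

variable {α : Measure X} [IsFiniteMeasure α]

/-- Bounded operators commuting with multiplication by indicator functions. -/
def CommutesWithIndicators (T : Lp K 2 α →L[ℂ] Lp K' 2 α) : Prop :=
  ∀ E, MeasurableSet E → ∀ F F' : Lp K 2 α, F' =ᵐ[α] E.indicator F →
    T F' =ᵐ[α] E.indicator (T F)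

theorem eLpNorm_two_sq {V : Type*} [NormedAddCommGroup V] {f : X → V} :
    eLpNorm f 2 α ^ 2 = ∫⁻ x, ‖f x‖ₑ ^ 2 ∂α := by
  have := eLpNorm_nnreal_pow_eq_lintegral (μ := α) (f := f) (p := 2) (by norm_num)
  simpa using this

/-- T sends χ_E v to χ_E T(v), so the integral of ‖T(v)(x)‖² over any Borel set E is at most ‖T‖²
‖v‖² α(E). Bounds on all sets E give the pointwise bound. -/
theorem CommutesWithIndicators.norm_apply_const_le {T : Lp K 2 α →L[ℂ] Lp K' 2 α}
    (hT : CommutesWithIndicators T) (v : K) :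
    ∀ᵐ x ∂α, ‖T (Lp.constL 2 α ℂ v) x‖ ≤ ‖T‖ * ‖v‖ := by
  set f := T (Lp.constL 2 α ℂ v) with hf
  have key : (fun x => ‖f x‖ₑ ^ 2) ≤ᵐ[α] fun _ => (‖T‖ₑ * ‖v‖ₑ) ^ 2 := by
    refine ae_le_of_forall_setLIntegral_le_of_sigmaFinite
      ((Lp.stronglyMeasurable f).enorm.pow_const 2) fun E hE _ => ?_
    set c := indicatorConstLp 2 hE (measure_ne_top α E) v with hc
    have h1 : c =ᵐ[α] E.indicator (Lp.constL 2 α ℂ v : Lp K 2 α) := by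
      filter_upwards [indicatorConstLp_coeFn (p := 2) (hs := hE) (hμs := measure_ne_top α E)
        (c := v), Lp.coeFn_const 2 α v] with x h1 h2
      rw [h1]
      by_cases hx : x ∈ E
      · simpa [hx] using h2.symm
      · simp [hx]
    have h2 := hT E hE _ c h1
    have h3 : ‖T c‖ₑ ≤ ‖T‖ₑ * ‖c‖ₑ := T.le_opENorm c
    have h4 : ‖T c‖ₑ ^ 2 = ∫⁻ x in E, ‖f x‖ₑ ^ 2 ∂α := by
      rw [Lp.enorm_def, eLpNorm_congr_ae h2, eLpNorm_two_sq, ← lintegral_indicator hE]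
      refine lintegral_congr fun x => ?_
      by_cases hx : x ∈ E <;> simp [hx, hf]
    have h5 : ‖c‖ₑ ^ 2 = ∫⁻ x in E, ‖v‖ₑ ^ 2 ∂α := by
      rw [Lp.enorm_def, eLpNorm_congr_ae indicatorConstLp_coeFn, eLpNorm_two_sq,
        ← lintegral_indicator hE]
      refine lintegral_congr fun x => ?_
      by_cases hx : x ∈ E <;> simp [hx]
    rw [← h4]
    refine (pow_le_pow_left' h3 2).trans ?_
    rw [mul_pow, h5]
    simp only [lintegral_const]
    rw [mul_pow, mul_assoc]
  filter_upwards [key] with x hx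
  have h1 : ‖f x‖ₑ ≤ ‖T‖ₑ * ‖v‖ₑ := (ENNReal.pow_le_pow_left_iff (by norm_num)).1 hx
  rw [← ofReal_norm, ← ofReal_norm, ← ofReal_norm, ← ENNReal.ofReal_mul (norm_nonneg _)] at h1
  exact (ENNReal.ofReal_le_ofReal_iff (by positivity)).1 h1

theorem linearCombination_eq_sum_fin {M : Type*} [AddCommGroup M] [Module ℂ M] {c : ℕ →₀ ℂ} {N : ℕ}
    (hN : c.support ⊆ Finset.range N) (u : ℕ → M) :
    Finsupp.linearCombination ℂ u c = ∑ i : Fin N, c i • u i := by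
  rw [Finsupp.linearCombination_apply, Finsupp.sum_of_support_subset c hN _ (by simp),
    Finset.sum_range]

/-- A bounded operator commuting with multiplication by indicator functions is decomposable. -/
theorem CommutesWithIndicators.exists_field [TopologicalSpace.SeparableSpace K']
    {T : Lp K 2 α →L[ℂ] Lp K' 2 α} (hT : CommutesWithIndicators T) :
    ∃ t : X → K →L[ℂ] K', OpMeasurable t ∧ ∀ F, T F =ᵐ[α] fun x => t x (F x) := by
  classical
  set d := TopologicalSpace.denseSeq K with hd
  set f : ℕ → X → K' := fun n => T (Lp.constL 2 α ℂ (d n)) with hf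
  have hfm : ∀ n, StronglyMeasurable (f n) := fun n => Lp.stronglyMeasurable _
  have hlin : ∀ (N : ℕ) (c : Fin N → ℂ), ∀ᵐ x ∂α,
      ‖∑ i, c i • f i x‖ ≤ ‖T‖ * ‖∑ i, c i • d i‖ := by
    intro N c
    have h1 : T (Lp.constL 2 α ℂ (∑ i, c i • d i)) =
        ∑ i, c i • T (Lp.constL 2 α ℂ (d i)) := by
      simp only [map_sum, map_smul]
    have h2 := Lp.coeFn_fun_finsetSum (Finset.univ : Finset (Fin N))
      (fun i => c i • T (Lp.constL 2 α ℂ (d i)))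
    have h3 : ∀ᵐ x ∂α, ∀ i : Fin N, (c i • T (Lp.constL 2 α ℂ (d i)) : Lp K' 2 α) x =
        c i • f i x := by
      rw [ae_all_iff]
      intro i
      exact Lp.coeFn_smul _ _
    filter_upwards [hT.norm_apply_const_le (∑ i, c i • d i), h2, h3] with x hx h2 h3
    rw [h1, h2] at hx
    simpa only [h3] using hx
  -- Only countably many inequalities are imposed, one for each coefficient vector in a dense
  -- sequence of each ℂᴺ, so almost every point is good. Continuity extends them to all coefficients
  -- in `hbound`.
  set good : Set X := {x | ∀ (N : ℕ) (k : ℕ),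
    ‖∑ i, (TopologicalSpace.denseSeq (Fin N → ℂ) k) i • f i x‖ ≤
      ‖T‖ * ‖∑ i, (TopologicalSpace.denseSeq (Fin N → ℂ) k) i • d i‖} with hgood
  have hgood_meas : MeasurableSet good := by
    simp only [hgood, Set.ofPred_forall]
    refine MeasurableSet.iInter fun N => MeasurableSet.iInter fun k => ?_
    refine measurableSet_le (StronglyMeasurable.measurable ?_) measurable_const
    exact (Finset.stronglyMeasurable_fun_sum Finset.univ fun (i : Fin N) _ =>
      (hfm i).const_smul (TopologicalSpace.denseSeq (Fin N → ℂ) k i)).norm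
  have hgood_ae : ∀ᵐ x ∂α, x ∈ good := by
    simp only [hgood, Set.mem_ofPred_eq]
    rw [ae_all_iff]
    intro N
    rw [ae_all_iff]
    intro k
    exact hlin N _
  set e := Finsupp.linearCombination ℂ d with he
  have hdense : DenseRange e := by
    refine (TopologicalSpace.denseRange_denseSeq K).mono ?_
    rintro _ ⟨n, rfl⟩
    exact ⟨Finsupp.single n 1, by simp [he, hd]⟩
  have hbound : ∀ x ∈ good, ∀ c : ℕ →₀ ℂ,
      ‖Finsupp.linearCombination ℂ (fun n => f n x) c‖ ≤ ‖T‖ * ‖e c‖ := by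
    intro x hx c
    obtain ⟨N, hN⟩ := c.support.exists_nat_subset_range
    rw [he, linearCombination_eq_sum_fin hN, linearCombination_eq_sum_fin hN]
    have hcl : IsClosed {c : Fin N → ℂ |
        ‖∑ i, c i • f i x‖ ≤ ‖T‖ * ‖∑ i, c i • d i‖} :=
      isClosed_le (by fun_prop) (by fun_prop)
    have := (TopologicalSpace.denseRange_denseSeq (Fin N → ℂ)).induction_on
      (p := fun c => ‖∑ i, c i • f i x‖ ≤ ‖T‖ * ‖∑ i, c i • d i‖)
      (fun i : Fin N => c i) hcl (fun k => hx N k)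
    exact this
  -- At a good point the bound makes ∑ c_n d_n ↦ ∑ c_n f_n(x) well defined and continuous on a dense
  -- subspace, so it extends to K with norm at most ‖T‖.
  set t : X → K →L[ℂ] K' := fun x => if x ∈ good then
    (Finsupp.linearCombination ℂ (fun n => f n x)).extendOfNorm e else 0 with ht
  have htd : ∀ x ∈ good, ∀ n, t x (d n) = f n x := by
    intro x hx n
    have h1 := LinearMap.extendOfNorm_eq (f := Finsupp.linearCombination ℂ (fun n => f n x))
      hdense ⟨‖T‖, hbound x hx⟩ (Finsupp.single n 1)
    simp only [he, Finsupp.linearCombination_single, one_smul] at h1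
    simp only [ht, if_pos hx]
    exact h1
  have htm : OpMeasurable t := by
    refine OpMeasurable.of_denseSeq fun n => ?_
    have : (fun x => t x (d n)) = good.indicator (f n) := by
      funext x
      by_cases hx : x ∈ good
      · rw [htd x hx, Set.indicator_of_mem hx]
      · simp [ht, hx]
    rw [← hd, this]
    exact (hfm n).indicator hgood_meas
  have htb : ∀ x, ‖t x‖ ≤ ‖T‖₊ := by
    intro x
    by_cases hx : x ∈ good
    · simp only [ht, if_pos hx]
      exact LinearMap.opNorm_extendOfNorm_le hdense (norm_nonneg _) (hbound x hx)
    · simp [ht, hx]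
  have hw := isWeightedComp_mul (α := α) htm ‖T‖₊ htb
  suffices h : ∀ F, T F = hw.op F from
    ⟨t, htm, fun F => by rw [h]; exact hw.coeFn_op F⟩
  -- Agreement on constants passes to indicators times vectors by commutation, and then to all of L²
  -- by density.
  have hconst : ∀ v, T (Lp.constL 2 α ℂ v) = hw.op (Lp.constL 2 α ℂ v) := by
    have : T ∘L Lp.constL 2 α ℂ = hw.op ∘L Lp.constL 2 α ℂ := by
      apply DFunLike.coe_injective
      refine (TopologicalSpace.denseRange_denseSeq K).equalizer
        (ContinuousLinearMap.continuous _) (ContinuousLinearMap.continuous _) ?_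
      funext n
      apply Lp.ext
      filter_upwards [hgood_ae, hw.coeFn_op (Lp.constL 2 α ℂ (d n)), Lp.coeFn_const 2 α (d n)]
        with x h1 h2 h3
      have h3' : (Lp.constL 2 α ℂ (d n) : Lp K 2 α) x = d n := h3
      have h4 : (hw.op (Lp.constL 2 α ℂ (d n))) x = f n x := by
        rw [h2, id, h3', htd x h1]
      exact h4.symm
    exact fun v => DFunLike.congr_fun this v
  intro F
  induction F using Lp.induction (by norm_num : (2 : ℝ≥0∞) ≠ ∞) with
  | indicatorConst c hs hμs =>
    rename_i s
    have h1 : (Lp.simpleFunc.indicatorConst 2 hs hμs.ne c : Lp K 2 α) =ᵐ[α]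
        s.indicator (Lp.constL 2 α ℂ c : Lp K 2 α) := by
      rw [Lp.simpleFunc.coe_indicatorConst]
      filter_upwards [indicatorConstLp_coeFn (p := 2) (hs := hs) (hμs := hμs.ne)
        (c := c), Lp.coeFn_const 2 α c] with x h1 h2
      rw [h1]
      by_cases hx : x ∈ s
      · simpa [hx] using h2.symm
      · simp [hx]
    apply Lp.ext
    filter_upwards [hT s hs _ _ h1, h1, hw.coeFn_op (Lp.simpleFunc.indicatorConst 2 hs hμs.ne c),
      hw.coeFn_op (Lp.constL 2 α ℂ c)] with x h2 h3 h4 h5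
    rw [h2, h4, id, h3]
    by_cases hx : x ∈ s
    · rw [Set.indicator_of_mem hx, Set.indicator_of_mem hx, hconst, h5, id]
    · simp [hx]
  | add hf hg _ h1 h2 => rw [map_add, map_add, h1, h2]
  | isClosed => exact isClosed_eq T.continuous hw.op.continuous

end Decomposable

/-! ### Every intertwiner of systems is induced -/

section Fullness

variable {G : Type*} [Group G] [TopologicalSpace G] [IsTopologicalGroup G] [LocallyCompactSpace G]
  [SecondCountableTopology G] [MeasurableSpace G] [BorelSpace G] {G₀ : Subgroup G}
  {m : Multiplier G}
  {K K' : Type*} [NormedAddCommGroup K] [InnerProductSpace ℂ K] [CompleteSpace K]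
  [TopologicalSpace.SeparableSpace K] [NormedAddCommGroup K'] [InnerProductSpace ℂ K']
  [CompleteSpace K'] [TopologicalSpace.SeparableSpace K']
  {D : MRep (m.restrict G₀) K} {D' : MRep (m.restrict G₀) K'}
  {φ : StrictCocycle m (G ⧸ G₀) K} {φ' : StrictCocycle m (G ⧸ G₀) K'}

theorem radonNikodym_pos {α : Measure (G ⧸ G₀)} (hα : InInvariantClass α) (g : G) :
    ∀ᵐ x ∂α, 0 < radonNikodym α g x := by
  have := hα.1
  have := sigmaFinite_map_smul α g⁻¹
  have hac := hα.absolutelyContinuous_map g⁻¹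
  filter_upwards [Measure.rnDeriv_pos hac,
    hac (Measure.rnDeriv_lt_top α (α.map fun y => g⁻¹ • y))] with x h1 h2
  exact ENNReal.toReal_pos h1.ne' h2.ne

/-- The operator field of a decomposable operator intertwining two cocycle operators intertwines
the cocycles. -/
theorem field_smul_comp_of_cocycleOp
    {T : Lp K 2 (canonicalMeasure G₀) →L[ℂ] Lp K' 2 (canonicalMeasure G₀)}
    {t : G ⧸ G₀ → K →L[ℂ] K'}
    (ht : ∀ F, T F =ᵐ[canonicalMeasure G₀] fun x => t x (F x)) {g : G}
    (hg : ∀ F, T (cocycleOp canonicalMeasure_inInvariantClass φ g F) =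
      cocycleOp canonicalMeasure_inInvariantClass φ' g (T F)) :
    ∀ᵐ x ∂canonicalMeasure G₀, t (g • x) ∘L φ.toCLM g x = φ'.toCLM g x ∘L t x := by
  have hc := canonicalMeasure_inInvariantClass (G₀ := G₀)
  -- Apply both operators to the constant functions of a dense sequence, so that one null set serves
  -- all vectors. The weight is positive almost everywhere and cancels.
  have key : ∀ᵐ x ∂canonicalMeasure G₀, ∀ n,
      t x (φ.f g (g⁻¹ • x) (TopologicalSpace.denseSeq K n)) =
        φ'.f g (g⁻¹ • x) (t (g⁻¹ • x) (TopologicalSpace.denseSeq K n)) := by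
    rw [ae_all_iff]
    intro n
    set v := TopologicalSpace.denseSeq K n
    have hq := hc.quasiMeasurePreserving g⁻¹
    filter_upwards [ht (cocycleOp hc φ g (Lp.const 2 _ v)), coeFn_cocycleOp hc φ g (Lp.const 2 _ v),
      coeFn_cocycleOp hc φ' g (T (Lp.const 2 _ v)), hq.ae (ht (Lp.const 2 _ v)),
      hq.ae (Lp.coeFn_const 2 (canonicalMeasure G₀) v), hq.ae (radonNikodym_pos hc g)]
      with x h1 h2 h3 h4 h5 h6
    rw [hg, h3, h2, h4, h5, map_smul] at h1
    refine (smul_right_injective _ ?_ h1).symm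
    exact Complex.ofReal_ne_zero.2 (Real.sqrt_pos.2 h6).ne'
  filter_upwards [(hc.quasiMeasurePreserving g).ae key] with x hx
  refine ContinuousLinearMap.ext_denseSeq fun n => ?_
  simpa [StrictCocycle.toCLM_apply] using hx n

/-- Every bounded operator intertwining the systems of imprimitivity defined by two strict
cocycles is induced by an operator intertwining the representations they define. -/
theorem exists_eq_inducedOp (hφ : φ.Defines D) (hφ' : φ'.Defines D')
    {T : Lp K 2 (canonicalMeasure G₀) →L[ℂ] Lp K' 2 (canonicalMeasure G₀)}
    (hT : CommutesWithIndicators T)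
    (hU : ∀ᵐ g ∂(Measure.haar : Measure G), ∀ F,
      T (cocycleOp canonicalMeasure_inInvariantClass φ g F) =
        cocycleOp canonicalMeasure_inInvariantClass φ' g (T F)) :
    ∃ T₀ : K →L[ℂ] K', IsIntertwiner D D' T₀ ∧ T = inducedOp φ φ' T₀ := by
  have hc := canonicalMeasure_inInvariantClass (G₀ := G₀)
  obtain ⟨t, htm, ht⟩ := hT.exists_field
  set a := fun g : G => φ.f g ((1 : G) : G ⧸ G₀) with ha
  set b := fun g : G => φ'.f g ((1 : G) : G ⧸ G₀) with hb
  -- The field is pulled back to G and conjugated into the fibre at x₀, so that an induced operator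
  -- would give a constant function.
  set s : G → K →L[ℂ] K' := fun g =>
    ((b g).symm.toContinuousLinearEquiv : K' →L[ℂ] K') ∘L t (g : G ⧸ G₀) ∘L
      φ.toCLM g ((1 : G) : G ⧸ G₀) with hs
  have hbs : ∀ g v, b g (s g v) = t (g : G ⧸ G₀) (a g v) := by
    intro g v
    simp [hs, ha, StrictCocycle.toCLM_apply]
  have hsm : OpMeasurable s := by
    have h1 : OpMeasurable fun g => φ.toCLM g ((1 : G) : G ⧸ G₀) :=
      φ.opMeasurable.comp_measurable (θ := fun g => (g, ((1 : G) : G ⧸ G₀))) (by fun_prop)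
    have h2 : OpMeasurable fun g => φ'.toCLM g ((1 : G) : G ⧸ G₀) :=
      φ'.opMeasurable.comp_measurable (θ := fun g => (g, ((1 : G) : G ⧸ G₀))) (by fun_prop)
    have h3 := h2.adjoint
    simp only [adjoint_toCLM] at h3
    exact h3.comp ((htm.comp_measurable QuotientGroup.measurable_coe).comp h1)
  have hinv : ∀ᵐ g ∂(Measure.haar : Measure G), ∀ᵐ y ∂(Measure.haar : Measure G),
      s (g * y) = s y := by
    filter_upwards [hU] with g hg
    filter_upwards [hc.ae_coe (field_smul_comp_of_cocycleOp ht hg)] with y hy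
    ext v
    apply (b (g * y)).injective
    rw [hbs, ha]
    simp only [hb]
    rw [cocycle_base, cocycle_base, map_smul]
    congr 1
    have h1 := DFunLike.congr_fun hy (a y v)
    simp only [ContinuousLinearMap.comp_apply, StrictCocycle.toCLM_apply, ← hbs] at h1
    exact h1
  have hmeas : MeasurableSet {p : G × G | s (p.1 * p.2) = s p.2} :=
    (hsm.comp_measurable measurable_mul).measurableSet_eq (hsm.comp_measurable measurable_snd)
  -- Fubini produces one y with s(gy) = s(y) for almost all g. Right translations preserve Haar null
  -- sets, so replacing g by gy⁻¹ makes s almost everywhere equal to s(y).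
  rw [Measure.ae_ae_comm hmeas] at hinv
  obtain ⟨y, hy⟩ := hinv.exists
  have hright : ∀ (h : G) {p : G → Prop}, (∀ᵐ g ∂(Measure.haar : Measure G), p g) →
      ∀ᵐ g ∂(Measure.haar : Measure G), p (g * h) := by
    intro h p hp
    rw [ae_iff] at hp ⊢
    exact (measure_mul_right_null Measure.haar h).2 hp
  have hconst : ∀ᵐ g ∂(Measure.haar : Measure G), s g = s y := by
    filter_upwards [hright y⁻¹ hy] with g hg
    simpa using hg
  have hT₀ : IsIntertwiner D D' (s y) := by
    intro h v
    -- Take g with both s(g) and s(gh) equal to the constant. Since gh and g lie in the same coset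
    -- they share the value of t, and comparing the two expressions for it gives the intertwining
    -- relation at h.
    obtain ⟨g, hg1, hg2⟩ := (hconst.and (hright (h : G) hconst)).exists
    have hx : ((h : G) : G ⧸ G₀) = ((1 : G) : G ⧸ G₀) := by
      rw [QuotientGroup.eq]; simp
    have hgh : ((g * h : G) : G ⧸ G₀) = (g : G ⧸ G₀) := by
      rw [QuotientGroup.eq]; simp
    have h1 := hbs (g * h) v
    simp only [ha, hb] at h1
    rw [cocycle_base, cocycle_base, map_smul, hgh, hx, hφ, hφ', hg2] at h1
    have h2 := smul_right_injective _ (Circle.coe_ne_zero _) h1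
    have h3 := hbs g (D.U h v)
    simp only [ha, hb] at h3
    rw [← h3, hg1] at h2
    exact ((b g).injective h2).symm
  refine ⟨s y, hT₀, ?_⟩
  have hfield : ∀ᵐ x ∂canonicalMeasure G₀, t x = fieldOp φ φ' (s y) x := by
    refine hc.ae_of_coe (htm.measurableSet_eq (opMeasurable_fieldOp hφ hφ' hT₀)) ?_
    filter_upwards [hconst] with g hg
    rw [fieldOp_coe hφ hφ' hT₀]
    ext v
    rw [conjOp_apply, ← hg]
    have := hbs g ((a g).symm v)
    rw [LinearIsometryEquiv.apply_symm_apply] at this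
    exact this.symm
  ext1 F
  apply Lp.ext
  filter_upwards [ht F, coeFn_inducedOp hφ hφ' hT₀ F, hfield] with x h1 h2 h3
  rw [h1, h2, h3]

end Fullness

/-! ### Commutants, irreducibility and Hilbert sums -/

section Commutant

variable {H J : Type*} [NormedAddCommGroup H] [InnerProductSpace ℂ H] [CompleteSpace H]

/-- A family of operators which is closed under adjoints up to scalars. -/
def AdjointClosed (A : J → H →L[ℂ] H) : Prop :=
  ∀ j, ∃ (k : J) (c : ℂ), ContinuousLinearMap.adjoint (A j) = c • A k

/-- Closure under adjoints makes the orthogonal complement of V invariant as well. -/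
theorem AdjointClosed.starProjection_comm {A : J → H →L[ℂ] H} (hA : AdjointClosed A)
    {V : Submodule ℂ H} [V.HasOrthogonalProjection] (hV : ∀ j, ∀ v ∈ V, A j v ∈ V) (j : J)
    (v : H) : V.starProjection (A j v) = A j (V.starProjection v) := by
  have horth : ∀ w ∈ Vᗮ, A j w ∈ Vᗮ := by
    intro w hw
    rw [Submodule.mem_orthogonal] at hw ⊢
    intro u hu
    obtain ⟨k, c, hk⟩ := hA j
    rw [← ContinuousLinearMap.adjoint_inner_left, hk, smul_apply, inner_smul_left,
      hw _ (hV k u hu), mul_zero]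
  refine Submodule.eq_starProjection_of_mem_orthogonal
    (hV j _ (Submodule.starProjection_apply_mem V v)) ?_
  rw [← map_sub]
  exact horth _ (Submodule.sub_starProjection_mem_orthogonal v)

/-- Closed invariant subspaces correspond to orthogonal projections in the commutant: a subspace
gives its projection, a projection the subspace of its fixed vectors. -/
theorem AdjointClosed.irreducible_iff {A : J → H →L[ℂ] H} (hA : AdjointClosed A) :
    (Nontrivial H ∧ ∀ V : Submodule ℂ H, IsClosed (V : Set H) →
      (∀ j, ∀ v ∈ V, A j v ∈ V) → V = ⊥ ∨ V = ⊤) ↔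
    ((1 : H →L[ℂ] H) ≠ 0 ∧ ∀ p : H →L[ℂ] H, IsStarProjection p →
      (∀ j v, p (A j v) = A j (p v)) → p = 0 ∨ p = 1) := by
  constructor
  · rintro ⟨hn, h⟩
    refine ⟨one_ne_zero, fun p hp hc => ?_⟩
    have hmem : ∀ v, v ∈ LinearMap.eqLocus (p : H →ₗ[ℂ] H) LinearMap.id ↔ p v = v := fun v =>
      Iff.rfl
    have hidem : ∀ v, p (p v) = p v := fun v => DFunLike.congr_fun hp.isIdempotentElem v
    rcases h (LinearMap.eqLocus (p : H →ₗ[ℂ] H) LinearMap.id)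
      (isClosed_eq p.continuous continuous_id) (fun j v hv => by
        rw [hmem] at hv ⊢
        rw [hc, hv]) with h1 | h1
    · left
      ext v
      have : p v ∈ LinearMap.eqLocus (p : H →ₗ[ℂ] H) LinearMap.id := (hmem _).2 (hidem v)
      rw [h1] at this
      simpa using this
    · right
      ext v
      have : v ∈ LinearMap.eqLocus (p : H →ₗ[ℂ] H) LinearMap.id := h1 ▸ Submodule.mem_top
      exact (hmem v).1 this
  · rintro ⟨h1, h⟩
    refine ⟨?_, fun V hV hinv => ?_⟩
    · by_contra hn
      rw [not_nontrivial_iff_subsingleton] at hn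
      exact h1 (Subsingleton.elim _ _)
    · have : CompleteSpace V := hV.completeSpace_coe
      rcases h V.starProjection isStarProjection_starProjection
        (hA.starProjection_comm hinv) with h2 | h2
      · left
        rw [eq_bot_iff]
        intro v hv
        have := Submodule.starProjection_eq_self_iff.2 hv
        rw [h2] at this
        simpa using this.symm
      · right
        rw [eq_top_iff]
        intro v _
        rw [← Submodule.starProjection_eq_self_iff, h2]
        rfl

variable {ι : Type*} {H' : ι → Type*} [∀ i, NormedAddCommGroup (H' i)]
  [∀ i, InnerProductSpace ℂ (H' i)]

theorem IsHilbertSum.ext_clm {E : Type*} [NormedAddCommGroup E] [NormedSpace ℂ E]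
    {V : ∀ i, H' i →ₗᵢ[ℂ] H}
    (hV : IsHilbertSum ℂ H' V) {A B : H →L[ℂ] E} (h : ∀ i v, A (V i v) = B (V i v)) : A = B := by
  ext x
  have hx := hV.hasSum_linearIsometryEquiv_symm (hV.linearIsometryEquiv x)
  rw [LinearIsometryEquiv.symm_apply_apply] at hx
  have hA := A.hasSum hx
  have hB := B.hasSum hx
  simp only [h] at hA
  exact hA.unique hB

/-- The unitary operator between two Hilbert sums of the same family. -/
theorem IsHilbertSum.exists_unitary {H₂ : Type*} [NormedAddCommGroup H₂] [InnerProductSpace ℂ H₂]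
    [CompleteSpace H₂] {V : ∀ i, H' i →ₗᵢ[ℂ] H} {V₂ : ∀ i, H' i →ₗᵢ[ℂ] H₂}
    (hV : IsHilbertSum ℂ H' V) (hV₂ : IsHilbertSum ℂ H' V₂) :
    ∃ W : H ≃ₗᵢ[ℂ] H₂, ∀ i v, W (V i v) = V₂ i v := by
  classical
  refine ⟨hV.linearIsometryEquiv.trans hV₂.linearIsometryEquiv.symm, fun i v => ?_⟩
  rw [← hV.linearIsometryEquiv_symm_apply_single, LinearIsometryEquiv.trans_apply,
    LinearIsometryEquiv.apply_symm_apply, hV₂.linearIsometryEquiv_symm_apply_single]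

variable [∀ i, CompleteSpace (H' i)]

/-- A jointly generating family of isometries with pairwise orthogonal ranges, where generation is
tested on the commutant of `A`. -/
structure IsGeneratingFamily (A : J → H →L[ℂ] H) (V : ∀ i, H' i →L[ℂ] H) : Prop where
  isometry : ∀ i, ContinuousLinearMap.adjoint (V i) ∘L V i = ContinuousLinearMap.id ℂ (H' i)
  orthogonal : ∀ i j, i ≠ j → ContinuousLinearMap.adjoint (V i) ∘L V j = 0
  total : ∀ T : H →L[ℂ] H, (∀ j v, T (A j v) = A j (T v)) → (∀ i, T ∘L V i = 0) → T = 0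

theorem IsHilbertSum.isGeneratingFamily {V : ∀ i, H' i →ₗᵢ[ℂ] H} (hV : IsHilbertSum ℂ H' V)
    (A : J → H →L[ℂ] H) : IsGeneratingFamily A fun i => (V i).toContinuousLinearMap where
  isometry i := by
    ext v
    refine ext_inner_left ℂ fun w => ?_
    rw [ContinuousLinearMap.comp_apply, ContinuousLinearMap.adjoint_inner_right]
    exact (V i).inner_map_map w v
  orthogonal i j hij := by
    ext v
    refine ext_inner_left ℂ fun w => ?_
    rw [ContinuousLinearMap.comp_apply, ContinuousLinearMap.adjoint_inner_right]
    simpa using hV.OrthogonalFamily hij w v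
  total T _ h := hV.ext_clm fun i v => by
    simpa using DFunLike.congr_fun (h i) v

/-- An operator `V` with `V† V = 1` as a linear isometry. -/
noncomputable def isometryOfAdjointComp {H₁ : Type*} [NormedAddCommGroup H₁]
    [InnerProductSpace ℂ H₁] [CompleteSpace H₁] (V : H₁ →L[ℂ] H)
    (h : ContinuousLinearMap.adjoint V ∘L V = ContinuousLinearMap.id ℂ H₁) : H₁ →ₗᵢ[ℂ] H where
  toLinearMap := V
  norm_map' v := by
    have h1 : ⟪V v, V v⟫_ℂ = ⟪v, v⟫_ℂ := by
      rw [← ContinuousLinearMap.adjoint_inner_right]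
      have := DFunLike.congr_fun h v
      simp only [ContinuousLinearMap.comp_apply, ContinuousLinearMap.id_apply] at this
      rw [this]
    rw [inner_self_eq_norm_sq_to_K, inner_self_eq_norm_sq_to_K] at h1
    have h2 : ‖V v‖ ^ 2 = ‖v‖ ^ 2 := by exact_mod_cast h1
    exact (pow_left_inj₀ (norm_nonneg _) (norm_nonneg _) two_ne_zero).1 h2

/-- The ranges are invariant, so the projection onto the closure of their span lies in the
commutant. Totality applied to its complement shows that the span is dense, so testing on the
commutant suffices, and only the commutant is visible to the correspondence. -/
theorem IsGeneratingFamily.isHilbertSum {A : J → H →L[ℂ] H} (hA : AdjointClosed A)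
    {V : ∀ i, H' i →L[ℂ] H} (hV : IsGeneratingFamily A V)
    (hinv : ∀ j i v, ∃ w, A j (V i v) = V i w) :
    IsHilbertSum ℂ H' fun i => isometryOfAdjointComp (V i) (hV.isometry i) := by
  set V' : ∀ i, H' i →ₗᵢ[ℂ] H := fun i => isometryOfAdjointComp (V i) (hV.isometry i) with hV'
  set R := ⨆ i, LinearMap.range (V' i).toLinearMap with hR
  refine IsHilbertSum.mk ?_ ?_
  · intro i j hij v w
    have := DFunLike.congr_fun (hV.orthogonal i j hij) w
    change ⟪V i v, V j w⟫_ℂ = 0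
    rw [← ContinuousLinearMap.adjoint_inner_right]
    simp only [ContinuousLinearMap.comp_apply, zero_apply] at this
    rw [this, inner_zero_right]
  · have hRinv : ∀ j, ∀ v ∈ R.topologicalClosure, A j v ∈ R.topologicalClosure := by
      intro j
      have h1 : R ≤ R.comap (A j : H →ₗ[ℂ] H) := by
        rw [hR]
        refine iSup_le fun i => ?_
        rintro _ ⟨v, rfl⟩
        obtain ⟨w, hw⟩ := hinv j i v
        refine Submodule.mem_comap.2 (Submodule.mem_iSup_of_mem i ?_)
        exact ⟨w, hw.symm⟩
      intro v hv
      exact map_mem_closure (A j).continuous hv fun u hu => h1 hu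
    have hcl : IsClosed (R.topologicalClosure : Set H) := R.isClosed_topologicalClosure
    have : CompleteSpace R.topologicalClosure := hcl.completeSpace_coe
    have h0 := hV.total (1 - R.topologicalClosure.starProjection) (fun j v => by
      simp only [sub_apply, one_apply_eq_self, hA.starProjection_comm hRinv, map_sub])
      (fun i => by
        ext v
        have hmem : V i v ∈ R.topologicalClosure :=
          R.le_topologicalClosure (Submodule.mem_iSup_of_mem i ⟨v, rfl⟩)
        simp [Submodule.starProjection_eq_self_iff.2 hmem])
    rw [sub_eq_zero] at h0
    intro v _
    rw [← Submodule.starProjection_eq_self_iff, ← h0]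
    rfl

end Commutant

/-! ### Representations and systems as adjoint closed families -/

section Systems

variable {G : Type*} [Group G] [MeasurableSpace G] {m : Multiplier G}
  {X : Type*} [MeasurableSpace X] [MulAction G X]
  {H : Type*} [NormedAddCommGroup H] [InnerProductSpace ℂ H] [CompleteSpace H]

/-- The unitary operators of an `m`-representation as bounded operators. -/
noncomputable def MRep.toCLM (D : MRep m H) (g : G) : H →L[ℂ] H :=
  ((D.U g).toContinuousLinearEquiv : H →L[ℂ] H)

theorem MRep.toCLM_apply (D : MRep m H) (g : G) (v : H) : D.toCLM g v = D.U g v := rfl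

theorem MRep.U_one (D : MRep m H) (v : H) : D.U 1 v = v := by
  have := D.map_mul 1 1 v
  rw [m.one_left', Circle.coe_one, one_smul, mul_one] at this
  exact ((D.U 1).injective this).symm

/-- From 1 = U(gg⁻¹) = m(g, g⁻¹) U(g) U(g⁻¹). This scalar is why `AdjointClosed` allows one. -/
theorem MRep.adjoint_toCLM (D : MRep m H) (g : G) :
    ContinuousLinearMap.adjoint (D.toCLM g) = (m g g⁻¹ : ℂ) • D.toCLM g⁻¹ := by
  symm
  rw [ContinuousLinearMap.eq_adjoint_iff]
  intro v w
  rw [smul_apply, ← (D.U g).inner_map_map, map_smul, MRep.toCLM_apply, MRep.toCLM_apply,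
    ← D.map_mul, mul_inv_cancel, D.U_one]

theorem MRep.adjointClosed (D : MRep m H) : AdjointClosed D.toCLM := fun g =>
  ⟨g⁻¹, m g g⁻¹, D.adjoint_toCLM g⟩

/-- The unitary operators and the projections of a system of imprimitivity as one family. -/
noncomputable def MSystem.family (S : MSystem m X H) :
    G ⊕ {E : Set X // MeasurableSet E} → H →L[ℂ] H :=
  Sum.elim S.toMRep.toCLM fun E => S.P E

theorem MSystem.adjointClosed (S : MSystem m X H) : AdjointClosed S.family := by
  rintro (g | E)
  · exact ⟨Sum.inl g⁻¹, m g g⁻¹, S.toMRep.adjoint_toCLM g⟩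
  · refine ⟨Sum.inr E, 1, ?_⟩
    rw [one_smul]
    exact (S.isStarProjection E E.2).isSelfAdjoint.adjoint_eq

/-- Bounded intertwining operators between systems of imprimitivity. -/
def IsSystemIntertwiner {H' : Type*} [NormedAddCommGroup H'] [InnerProductSpace ℂ H']
    [CompleteSpace H'] (S : MSystem m X H) (S' : MSystem m X H') (T : H →L[ℂ] H') : Prop :=
  (∀ g v, T (S.U g v) = S'.U g (T v)) ∧ ∀ E, MeasurableSet E → ∀ v, T (S.P E v) = S'.P E (T v)

theorem MSystem.family_comm_iff (S : MSystem m X H) (T : H →L[ℂ] H) :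
    (∀ j v, T (S.family j v) = S.family j (T v)) ↔ IsSystemIntertwiner S S T :=
  ⟨fun h => ⟨fun g => h (Sum.inl g), fun E hE => h (Sum.inr ⟨E, hE⟩)⟩, fun h => by
    rintro (g | E)
    · exact h.1 g
    · exact h.2 E E.2⟩

theorem MSystem.mem_commutingRing (S : MSystem m X H) (T : H →L[ℂ] H) :
    T ∈ S.commutingRing ↔ IsSystemIntertwiner S S T := by
  refine and_congr Iff.rfl (forall₂_congr fun E _ => ?_)
  rw [ContinuousLinearMap.ext_iff]
  rfl

/-- Irreducibility of a `*`-algebra of operators. -/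
def IsTrivialStarAlgebra (R : Type*) [Ring R] [StarRing R] : Prop :=
  (1 : R) ≠ 0 ∧ ∀ p : R, IsStarProjection p → p = 0 ∨ p = 1

theorem isTrivialStarAlgebra_iff (R : StarSubalgebra ℂ (H →L[ℂ] H)) :
    IsTrivialStarAlgebra R ↔ (1 : H →L[ℂ] H) ≠ 0 ∧ ∀ p : H →L[ℂ] H, IsStarProjection p →
      p ∈ R → p = 0 ∨ p = 1 := by
  simp only [IsTrivialStarAlgebra, isStarProjection_iff, IsIdempotentElem, IsSelfAdjoint,
    Subtype.forall, ne_eq, Subtype.ext_iff]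
  simp only [StarMemClass.coe_star, MulMemClass.coe_mul, ZeroMemClass.coe_zero, OneMemClass.coe_one]
  exact and_congr Iff.rfl ⟨fun h p hp hR => h p hR hp, fun h p hR hp => h p hp hR⟩

theorem IsTrivialStarAlgebra.of_equiv {R R' : Type*} [Ring R] [StarRing R] [Algebra ℂ R]
    [Ring R'] [StarRing R'] [Algebra ℂ R'] (e : R ≃⋆ₐ[ℂ] R') (h : IsTrivialStarAlgebra R) :
    IsTrivialStarAlgebra R' := by
  refine ⟨fun h0 => h.1 (e.injective (by rw [map_one, map_zero, h0])), fun p hp => ?_⟩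
  have hp' : IsStarProjection (e.symm p) := by
    refine ⟨?_, ?_⟩
    · have := hp.isIdempotentElem
      rw [IsIdempotentElem] at this ⊢
      rw [← map_mul, this]
    · have := hp.isSelfAdjoint
      rw [IsSelfAdjoint] at this ⊢
      rw [← map_star, this]
  refine (h.2 _ hp').imp (fun h => ?_) fun h => ?_
  · rw [← e.apply_symm_apply p, h, map_zero]
  · rw [← e.apply_symm_apply p, h, map_one]

theorem MRep.isIrreducible_iff (D : MRep m H) :
    D.IsIrreducible ↔ IsTrivialStarAlgebra D.commutingRing := by
  rw [isTrivialStarAlgebra_iff]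
  exact D.adjointClosed.irreducible_iff

theorem MSystem.isIrreducible_iff (S : MSystem m X H) :
    S.IsIrreducible ↔ IsTrivialStarAlgebra S.commutingRing := by
  rw [isTrivialStarAlgebra_iff]
  simp only [MSystem.mem_commutingRing, ← MSystem.family_comm_iff]
  rw [← S.adjointClosed.irreducible_iff]
  refine and_congr Iff.rfl (forall₂_congr fun V _ => ?_)
  exact ⟨fun h h1 => h (fun g => h1 (Sum.inl g)) fun E hE => h1 (Sum.inr ⟨E, hE⟩),
    fun h h1 h2 => h (by
      rintro (g | E)
      · exact h1 g
      · exact h2 E E.2)⟩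

variable {ι : Type*} {H' : ι → Type*} [∀ i, NormedAddCommGroup (H' i)]
  [∀ i, InnerProductSpace ℂ (H' i)] [∀ i, CompleteSpace (H' i)]

theorem MRep.isDirectSum_iff (D : MRep m H) (D' : ∀ i, MRep m (H' i)) :
    D.IsDirectSum D' ↔ ∃ V : ∀ i, H' i →L[ℂ] H, (∀ i, IsIntertwiner (D' i) D (V i)) ∧
      IsGeneratingFamily D.toCLM V := by
  constructor
  · rintro ⟨V, hV, h⟩
    exact ⟨_, fun i g v => (h i g v).symm, hV.isGeneratingFamily _⟩
  · rintro ⟨V, h, hV⟩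
    exact ⟨_, hV.isHilbertSum D.adjointClosed fun g i v => ⟨(D' i).U g v, (h i g v).symm⟩,
      fun i g v => (h i g v).symm⟩

theorem MSystem.isDirectSum_iff (S : MSystem m X H) (S' : ∀ i, MSystem m X (H' i)) :
    S.IsDirectSum S' ↔ ∃ V : ∀ i, H' i →L[ℂ] H, (∀ i, IsSystemIntertwiner (S' i) S (V i)) ∧
      IsGeneratingFamily S.family V := by
  constructor
  · rintro ⟨V, hV, h, h'⟩
    exact ⟨_, fun i => ⟨fun g v => (h i g v).symm, fun E hE v => (h' i E hE v).symm⟩,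
      hV.isGeneratingFamily _⟩
  · rintro ⟨V, h, hV⟩
    refine ⟨_, hV.isHilbertSum S.adjointClosed ?_,
      fun i g v => ((h i).1 g v).symm, fun i E hE v => ((h i).2 E hE v).symm⟩
    rintro (g | E) i v
    · exact ⟨(S' i).U g v, ((h i).1 g v).symm⟩
    · exact ⟨(S' i).P E v, ((h i).2 E E.2 v).symm⟩

end Systems

/-! ### Intertwiners of abstract systems -/

section Lift

variable {G : Type*} [Group G] [TopologicalSpace G] [IsTopologicalGroup G] [LocallyCompactSpace G]
  [SecondCountableTopology G] [MeasurableSpace G] [BorelSpace G] {G₀ : Subgroup G}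
  {m : Multiplier G}

/-- An operator intertwining two `m`-representations at almost all group elements intertwines them
at all group elements. -/
theorem IsIntertwiner.of_ae {H H' : Type*} [NormedAddCommGroup H] [InnerProductSpace ℂ H]
    [NormedAddCommGroup H'] [InnerProductSpace ℂ H'] {U : MRep m H} {U' : MRep m H'}
    {T : H →L[ℂ] H'}
    (h : ∀ᵐ g ∂(Measure.haar : Measure G), ∀ v, T (U.U g v) = U'.U g (T v)) :
    IsIntertwiner U U' T := by
  intro g v
  -- Every g is a product a · a⁻¹g with both factors outside the exceptional null set, because
  -- inversion and right translation preserve Haar null sets.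
  have h1 : ∀ {p : G → Prop}, (∀ᵐ a ∂(Measure.haar : Measure G), p a) →
      ∀ᵐ a ∂(Measure.haar : Measure G), p (a⁻¹ * g) := by
    intro p hp
    have h2 : ∀ᵐ a ∂(Measure.haar : Measure G), p (a * g) := by
      rw [ae_iff] at hp ⊢
      exact (measure_mul_right_null Measure.haar g).2 hp
    have h3 := (quasiMeasurePreserving_inv (Measure.haar : Measure G)).preimage_null (ae_iff.1 h2)
    rw [ae_iff]
    exact h3
  obtain ⟨a, ha, hb⟩ := (h.and (h1 h)).exists
  rw [show g = a * (a⁻¹ * g) by group, U.map_mul, U'.map_mul, map_smul, ha, hb]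

variable {K K' K'' H H' H'' : Type*} [NormedAddCommGroup K] [InnerProductSpace ℂ K]
  [CompleteSpace K] [TopologicalSpace.SeparableSpace K]
  [NormedAddCommGroup K'] [InnerProductSpace ℂ K']
  [CompleteSpace K'] [TopologicalSpace.SeparableSpace K']
  [NormedAddCommGroup K''] [InnerProductSpace ℂ K'']
  [CompleteSpace K''] [TopologicalSpace.SeparableSpace K'']
  [NormedAddCommGroup H] [InnerProductSpace ℂ H] [CompleteSpace H]
  [NormedAddCommGroup H'] [InnerProductSpace ℂ H'] [CompleteSpace H']
  [NormedAddCommGroup H''] [InnerProductSpace ℂ H''] [CompleteSpace H'']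
  {D : MRep (m.restrict G₀) K} {D' : MRep (m.restrict G₀) K'} {D'' : MRep (m.restrict G₀) K''}
  {S : MSystem m (G ⧸ G₀) H} {S' : MSystem m (G ⧸ G₀) H'} {S'' : MSystem m (G ⧸ G₀) H''}
  {φ : StrictCocycle m (G ⧸ G₀) K} {φ' : StrictCocycle m (G ⧸ G₀) K'}
  {φ'' : StrictCocycle m (G ⧸ G₀) K''}
  {W : H ≃ₗᵢ[ℂ] Lp K 2 (canonicalMeasure G₀)} {W' : H' ≃ₗᵢ[ℂ] Lp K' 2 (canonicalMeasure G₀)}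
  {W'' : H'' ≃ₗᵢ[ℂ] Lp K'' 2 (canonicalMeasure G₀)}

/-- The operator between the spaces of two systems of imprimitivity induced by an operator between
the spaces of the representations to which they are associated. -/
noncomputable def liftOp (φ : StrictCocycle m (G ⧸ G₀) K) (φ' : StrictCocycle m (G ⧸ G₀) K')
    (W : H ≃ₗᵢ[ℂ] Lp K 2 (canonicalMeasure G₀)) (W' : H' ≃ₗᵢ[ℂ] Lp K' 2 (canonicalMeasure G₀))
    (T : K →L[ℂ] K') : H →L[ℂ] H' :=
  (W'.symm.toContinuousLinearEquiv : _ →L[ℂ] H') ∘L inducedOp φ φ' T ∘L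
    (W.toContinuousLinearEquiv : H →L[ℂ] _)

theorem liftOp_apply (T : K →L[ℂ] K') (v : H) :
    liftOp φ φ' W W' T v = W'.symm (inducedOp φ φ' T (W v)) := rfl

/-- A model prescribes the unitaries only for almost all g; `IsIntertwiner.of_ae` upgrades the
relation to every g. -/
theorem isSystemIntertwiner_liftOp (hM : IsModel D S φ W) (hM' : IsModel D' S' φ' W')
    {T : K →L[ℂ] K'} (hT : IsIntertwiner D D' T) :
    IsSystemIntertwiner S S' (liftOp φ φ' W W' T) := by
  refine ⟨IsIntertwiner.of_ae (U := S.toMRep) (U' := S'.toMRep) ?_, fun E hE v => ?_⟩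
  · filter_upwards [hM.unit, hM'.unit] with g h1 h2 v
    apply W'.injective
    rw [h2, liftOp_apply, liftOp_apply, W'.apply_symm_apply, W'.apply_symm_apply, h1,
      inducedOp_cocycleOp hM.base hM'.base hT]
  · apply W'.injective
    apply Lp.ext
    refine EventuallyEq.trans ?_ (hM'.proj E hE _).symm
    rw [liftOp_apply, liftOp_apply, W'.apply_symm_apply, W'.apply_symm_apply]
    exact inducedOp_indicator hM.base hM'.base hT (hM.proj E hE v)

theorem exists_eq_liftOp (hM : IsModel D S φ W) (hM' : IsModel D' S' φ' W')
    {T : H →L[ℂ] H'} (hT : IsSystemIntertwiner S S' T) :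
    ∃ T₀ : K →L[ℂ] K', IsIntertwiner D D' T₀ ∧ T = liftOp φ φ' W W' T₀ := by
  set R : Lp K 2 (canonicalMeasure G₀) →L[ℂ] Lp K' 2 (canonicalMeasure G₀) :=
    (W'.toContinuousLinearEquiv : H' →L[ℂ] _) ∘L T ∘L
      (W.symm.toContinuousLinearEquiv : _ →L[ℂ] H) with hR
  have hRa : ∀ F, R F = W' (T (W.symm F)) := fun F => rfl
  obtain ⟨T₀, h1, h2⟩ := exists_eq_inducedOp hM.base hM'.base (T := R) (fun E hE F F' hF => by
      have h3 : F' = W (S.P E (W.symm F)) := by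
        apply Lp.ext
        refine hF.trans ?_
        have := hM.proj E hE (W.symm F)
        rw [W.apply_symm_apply] at this
        exact this.symm
      rw [hRa, hRa, h3, W.symm_apply_apply, hT.2 E hE]
      exact hM'.proj E hE _) (by
      filter_upwards [hM.unit, hM'.unit] with g h3 h4 F
      have h5 := h3 (W.symm F)
      rw [W.apply_symm_apply] at h5
      rw [← h5, hRa, hRa, W.symm_apply_apply, hT.1, h4])
  refine ⟨T₀, h1, ?_⟩
  ext v
  rw [liftOp_apply, ← h2, hRa, W.symm_apply_apply, W'.symm_apply_apply]

theorem liftOp_comp (hM : IsModel D S φ W) (hM' : IsModel D' S' φ' W')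
    (hM'' : IsModel D'' S'' φ'' W'') {T : K →L[ℂ] K'} {T' : K' →L[ℂ] K''}
    (hT : IsIntertwiner D D' T) (hT' : IsIntertwiner D' D'' T') :
    liftOp φ φ'' W W'' (T' ∘L T) = liftOp φ' φ'' W' W'' T' ∘L liftOp φ φ' W W' T := by
  ext v
  rw [ContinuousLinearMap.comp_apply, liftOp_apply, liftOp_apply, liftOp_apply,
    inducedOp_comp hM.base hM'.base hM''.base hT hT', W'.apply_symm_apply]
  rfl

theorem liftOp_id (hM : IsModel D S φ W) :
    liftOp φ φ W W (ContinuousLinearMap.id ℂ K) = ContinuousLinearMap.id ℂ H := by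
  ext v
  rw [liftOp_apply, inducedOp_id hM.base]
  simp

theorem liftOp_add (hM : IsModel D S φ W) (hM' : IsModel D' S' φ' W') {T T' : K →L[ℂ] K'}
    (hT : IsIntertwiner D D' T) (hT' : IsIntertwiner D D' T') :
    liftOp φ φ' W W' (T + T') = liftOp φ φ' W W' T + liftOp φ φ' W W' T' := by
  ext v
  simp only [liftOp_apply, inducedOp_add hM.base hM'.base hT hT', add_apply, map_add]

theorem liftOp_smul (hM : IsModel D S φ W) (hM' : IsModel D' S' φ' W') (c : ℂ)
    {T : K →L[ℂ] K'} (hT : IsIntertwiner D D' T) :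
    liftOp φ φ' W W' (c • T) = c • liftOp φ φ' W W' T := by
  ext v
  simp only [liftOp_apply, inducedOp_smul hM.base hM'.base c hT, smul_apply, map_smul]

theorem liftOp_zero (hM : IsModel D S φ W) (hM' : IsModel D' S' φ' W') :
    liftOp φ φ' W W' 0 = 0 := by
  have := liftOp_smul hM hM' 0 (IsIntertwiner.zero (D := D) (D' := D'))
  rwa [zero_smul, zero_smul] at this

theorem liftOp_adjoint (hM : IsModel D S φ W) (hM' : IsModel D' S' φ' W') {T : K →L[ℂ] K'}
    (hT : IsIntertwiner D D' T) :
    liftOp φ' φ W' W (ContinuousLinearMap.adjoint T) =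
      ContinuousLinearMap.adjoint (liftOp φ φ' W W' T) := by
  rw [ContinuousLinearMap.eq_adjoint_iff]
  intro v w
  rw [liftOp_apply, liftOp_apply, inducedOp_adjoint hM.base hM'.base hT, ← W.inner_map_map,
    ← W'.inner_map_map, W.apply_symm_apply, W'.apply_symm_apply,
    ContinuousLinearMap.adjoint_inner_left]

theorem liftOp_injective (hM : IsModel D S φ W) (hM' : IsModel D' S' φ' W') {T T' : K →L[ℂ] K'}
    (hT : IsIntertwiner D D' T) (hT' : IsIntertwiner D D' T')
    (h : liftOp φ φ' W W' T = liftOp φ φ' W W' T') : T = T' := by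
  refine inducedOp_injective hM.base hM'.base hT hT' ?_
  ext1 F
  have := DFunLike.congr_fun h (W.symm F)
  rw [liftOp_apply, liftOp_apply, W.apply_symm_apply] at this
  exact W'.symm.injective this

/-- The isomorphism of the commuting rings of a representation and of a system of imprimitivity
associated to it. -/
theorem IsModel.nonempty_commutingRing_equiv (hM : IsModel D S φ W) :
    Nonempty (D.commutingRing ≃⋆ₐ[ℂ] S.commutingRing) := by
  have hI : ∀ T : D.commutingRing, IsIntertwiner D D (T : K →L[ℂ] K) := fun T => T.2
  set f : D.commutingRing →⋆ₐ[ℂ] S.commutingRing :=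
    { toFun := fun T => ⟨liftOp φ φ W W T,
        (S.mem_commutingRing _).2 (isSystemIntertwiner_liftOp hM hM (hI T))⟩
      map_one' := Subtype.ext (liftOp_id hM)
      map_mul' := fun T T' => Subtype.ext (liftOp_comp hM hM hM (hI T') (hI T))
      map_zero' := Subtype.ext (liftOp_zero hM hM)
      map_add' := fun T T' => Subtype.ext (liftOp_add hM hM (hI T) (hI T'))
      commutes' := fun c => by
        apply Subtype.ext
        change liftOp φ φ W W (algebraMap ℂ (K →L[ℂ] K) c) = algebraMap ℂ (H →L[ℂ] H) c
        rw [Algebra.algebraMap_eq_smul_one, Algebra.algebraMap_eq_smul_one]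
        exact (liftOp_smul hM hM c IsIntertwiner.id).trans (by rw [liftOp_id hM]; rfl)
      map_star' := fun T => Subtype.ext (liftOp_adjoint hM hM (hI T)) } with hf
  refine ⟨StarAlgEquiv.ofBijective f ⟨fun T T' h => ?_, fun R => ?_⟩⟩
  · exact Subtype.ext (liftOp_injective hM hM (hI T) (hI T') (congrArg Subtype.val h))
  · obtain ⟨T₀, h1, h2⟩ := exists_eq_liftOp hM hM ((S.mem_commutingRing _).1 R.2)
    exact ⟨⟨T₀, h1⟩, Subtype.ext h2.symm⟩

end Lift

/-! ### Direct sums -/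

section DirectSum

/-- Apply `IsGeneratingFamily.isHilbertSum` to the empty family, whose commutant consists of all
bounded operators. -/
theorem IsHilbertSum.of_total {H ι : Type*} [NormedAddCommGroup H] [InnerProductSpace ℂ H]
    [CompleteSpace H] {H' : ι → Type*} [∀ i, NormedAddCommGroup (H' i)]
    [∀ i, InnerProductSpace ℂ (H' i)] [∀ i, CompleteSpace (H' i)] {V : ∀ i, H' i →ₗᵢ[ℂ] H}
    (horth : ∀ i j, i ≠ j → ∀ v w, ⟪V i v, V j w⟫_ℂ = 0)
    (htotal : ∀ T : H →L[ℂ] H, (∀ i v, T (V i v) = 0) → T = 0) : IsHilbertSum ℂ H' V := by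
  have hV : IsGeneratingFamily (fun e : Empty => (e.elim : H →L[ℂ] H))
      fun i => (V i).toContinuousLinearMap :=
    { isometry := fun i => by
        ext v
        refine ext_inner_left ℂ fun w => ?_
        rw [ContinuousLinearMap.comp_apply, ContinuousLinearMap.adjoint_inner_right]
        exact (V i).inner_map_map w v
      orthogonal := fun i j hij => by
        ext v
        refine ext_inner_left ℂ fun w => ?_
        rw [ContinuousLinearMap.comp_apply, ContinuousLinearMap.adjoint_inner_right]
        simpa using horth i j hij w v
      total := fun T _ h => htotal T fun i v => DFunLike.congr_fun (h i) v }
  exact hV.isHilbertSum (fun e => e.elim) fun e => e.elim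

/-- The direct sum of strict cocycles. -/
theorem StrictCocycle.exists_directSum {G X K ι : Type*} [Group G] [MeasurableSpace G]
    {m : Multiplier G} [MeasurableSpace X] [MulAction G X] [Countable ι]
    [NormedAddCommGroup K] [InnerProductSpace ℂ K] [CompleteSpace K]
    {K' : ι → Type*} [∀ i, NormedAddCommGroup (K' i)] [∀ i, InnerProductSpace ℂ (K' i)]
    [∀ i, CompleteSpace (K' i)] {V : ∀ i, K' i →ₗᵢ[ℂ] K} (hV : IsHilbertSum ℂ K' V)
    (φ' : ∀ i, StrictCocycle m X (K' i)) :
    ∃ φ : StrictCocycle m X K, ∀ g x i v, φ.f g x (V i v) = V i ((φ' i).f g x v) := by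
  have hex : ∀ g x, ∃ W : K ≃ₗᵢ[ℂ] K, ∀ i v, W (V i v) = V i ((φ' i).f g x v) := by
    intro g x
    -- Each φ_i(g, x) is onto, so precomposing with it leaves the ranges unchanged and yields a
    -- second decomposition of K. The unitary matching the two is the value of the sum cocycle.
    have h2 : IsHilbertSum ℂ K' fun i => (V i).comp ((φ' i).f g x).toLinearIsometry := by
      refine IsHilbertSum.of_total (fun i j hij v w => hV.OrthogonalFamily hij _ _) fun T hT => ?_
      refine hV.ext_clm fun i v => ?_
      have := hT i (((φ' i).f g x).symm v)
      simpa using this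
    exact hV.exists_unitary h2
  choose f hf using hex
  refine ⟨{ f := f
            measurable_inner := fun v w => ?_
            map_one := fun x v => ?_
            map_mul := fun g₁ g₂ x v => ?_ }, hf⟩
  · have hw := hV.hasSum_linearIsometryEquiv_symm (hV.linearIsometryEquiv w)
    rw [LinearIsometryEquiv.symm_apply_apply] at hw
    set u := hV.linearIsometryEquiv w
    refine measurable_of_tendsto_metrizable' (atTop : Filter (Finset ι))
      (f := fun s p => ∑ i ∈ s, ⟪v, V i ((φ' i).f p.1 p.2 (u i))⟫_ℂ) (fun s => ?_) ?_
    · refine Finset.measurable_fun_sum _ fun i _ => ?_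
      have := (φ' i).measurable_inner
        (ContinuousLinearMap.adjoint (V i).toContinuousLinearMap v) (u i)
      simp only [ContinuousLinearMap.adjoint_inner_left] at this
      exact this
    · rw [tendsto_pi_nhds]
      intro p
      have h1 := (innerSL ℂ v ∘L ((f p.1 p.2).toContinuousLinearEquiv : K →L[ℂ] K)).hasSum hw
      simp only [ContinuousLinearMap.comp_apply, innerSL_apply_apply,
        ContinuousLinearEquiv.coe_coe, LinearIsometryEquiv.coe_toContinuousLinearEquiv, hf] at h1
      exact h1
  · have := hV.ext_clm (A := ((f 1 x).toContinuousLinearEquiv : K →L[ℂ] K))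
      (B := ContinuousLinearMap.id ℂ K) fun i v => by
        simp [hf, (φ' i).map_one]
    exact DFunLike.congr_fun this v
  · have := hV.ext_clm (A := ((f (g₁ * g₂) x).toContinuousLinearEquiv : K →L[ℂ] K))
      (B := (m g₁ g₂ : ℂ) • (((f g₁ (g₂ • x)).toContinuousLinearEquiv : K →L[ℂ] K) ∘L
        ((f g₂ x).toContinuousLinearEquiv : K →L[ℂ] K))) fun i v => by
        simp [hf, (φ' i).map_mul]
    exact DFunLike.congr_fun this v

variable {G : Type*} [Group G] [TopologicalSpace G] [IsTopologicalGroup G] [LocallyCompactSpace G]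
  [SecondCountableTopology G] [MeasurableSpace G] [BorelSpace G] {G₀ : Subgroup G}
  {m : Multiplier G}
  {K H : Type*} [NormedAddCommGroup K] [InnerProductSpace ℂ K]
  [CompleteSpace K] [TopologicalSpace.SeparableSpace K]
  [NormedAddCommGroup H] [InnerProductSpace ℂ H] [CompleteSpace H]
  {D : MRep (m.restrict G₀) K} {S : MSystem m (G ⧸ G₀) H}
  {φ : StrictCocycle m (G ⧸ G₀) K} {W : H ≃ₗᵢ[ℂ] Lp K 2 (canonicalMeasure G₀)}
  {ι : Type*} {K' H' : ι → Type*}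
  [∀ i, NormedAddCommGroup (K' i)] [∀ i, InnerProductSpace ℂ (K' i)]
  [∀ i, CompleteSpace (K' i)] [∀ i, TopologicalSpace.SeparableSpace (K' i)]
  [∀ i, NormedAddCommGroup (H' i)] [∀ i, InnerProductSpace ℂ (H' i)]
  [∀ i, CompleteSpace (H' i)]
  {D' : ∀ i, MRep (m.restrict G₀) (K' i)} {S' : ∀ i, MSystem m (G ⧸ G₀) (H' i)}
  {φ' : ∀ i, StrictCocycle m (G ⧸ G₀) (K' i)}
  {W' : ∀ i, H' i ≃ₗᵢ[ℂ] Lp (K' i) 2 (canonicalMeasure G₀)}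

/-- A generating family is described by products, adjoints and the commutant alone. Lifting
preserves all three, and is injective and surjective on intertwiners, so the family can be moved
either way. -/
theorem IsModel.isDirectSum_iff (hM : IsModel D S φ W)
    (hM' : ∀ i, IsModel (D' i) (S' i) (φ' i) (W' i)) :
    D.IsDirectSum D' ↔ S.IsDirectSum S' := by
  rw [MRep.isDirectSum_iff, MSystem.isDirectSum_iff]
  constructor
  · rintro ⟨V, hI, hV⟩
    refine ⟨fun i => liftOp (φ' i) φ (W' i) W (V i),
      fun i => isSystemIntertwiner_liftOp (hM' i) hM (hI i), fun i => ?_, fun i j hij => ?_,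
      fun T hT h => ?_⟩
    · rw [← liftOp_adjoint (hM' i) hM (hI i),
        ← liftOp_comp (hM' i) hM (hM' i) (hI i) (hI i).adjoint, hV.isometry, liftOp_id (hM' i)]
    · rw [← liftOp_adjoint (hM' i) hM (hI i),
        ← liftOp_comp (hM' j) hM (hM' i) (hI j) (hI i).adjoint, hV.orthogonal i j hij,
        liftOp_zero (hM' j) (hM' i)]
    · obtain ⟨T₀, h1, rfl⟩ := exists_eq_liftOp hM hM ((S.family_comm_iff T).1 hT)
      rw [hV.total T₀ h1 fun i => ?_, liftOp_zero hM hM]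
      refine liftOp_injective (hM' i) hM (h1.comp (hI i)) IsIntertwiner.zero ?_
      rw [liftOp_comp (hM' i) hM hM (hI i) h1, h i, liftOp_zero (hM' i) hM]
  · rintro ⟨R, hI, hR⟩
    choose V hVI hVR using fun i => exists_eq_liftOp (hM' i) hM (hI i)
    refine ⟨V, hVI, fun i => ?_, fun i j hij => ?_, fun T hT h => ?_⟩
    · refine liftOp_injective (hM' i) (hM' i) ((hVI i).adjoint.comp (hVI i)) IsIntertwiner.id ?_
      rw [liftOp_comp (hM' i) hM (hM' i) (hVI i) (hVI i).adjoint,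
        liftOp_adjoint (hM' i) hM (hVI i), ← hVR, hR.isometry, liftOp_id (hM' i)]
    · refine liftOp_injective (hM' j) (hM' i) ((hVI i).adjoint.comp (hVI j)) IsIntertwiner.zero ?_
      rw [liftOp_comp (hM' j) hM (hM' i) (hVI j) (hVI i).adjoint,
        liftOp_adjoint (hM' i) hM (hVI i), ← hVR, ← hVR, hR.orthogonal i j hij,
        liftOp_zero (hM' j) (hM' i)]
    · have hT' : IsIntertwiner D D T := hT
      refine liftOp_injective hM hM hT' IsIntertwiner.zero ?_
      rw [liftOp_zero hM hM]
      refine hR.total _ ((S.family_comm_iff _).2 (isSystemIntertwiner_liftOp hM hM hT'))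
        fun i => ?_
      rw [hVR i, ← liftOp_comp (hM' i) hM hM (hVI i) hT', h i, liftOp_zero (hM' i) hM]

/-- Multiplication by an indicator function as a bounded operator on `L²`. -/
theorem exists_indicator_clm {E : Set (G ⧸ G₀)} (hE : MeasurableSet E) :
    ∃ Q : Lp K 2 (canonicalMeasure G₀) →L[ℂ] Lp K 2 (canonicalMeasure G₀),
      ∀ F, Q F =ᵐ[canonicalMeasure G₀] E.indicator F := by
  classical
  set t : G ⧸ G₀ → K →L[ℂ] K := E.indicator fun _ => ContinuousLinearMap.id ℂ K with ht
  have htm : OpMeasurable t := by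
    intro v
    have : (fun x => t x v) = E.indicator fun _ => v := by
      funext x
      by_cases hx : x ∈ E <;> simp [ht, hx]
    rw [this]
    exact stronglyMeasurable_const.indicator hE
  have hw := isWeightedComp_mul (α := canonicalMeasure G₀) htm 1 fun x => by
    by_cases hx : x ∈ E
    · simpa [ht, hx] using ContinuousLinearMap.norm_id_le
    · simp [ht, hx]
  refine ⟨hw.op, fun F => ?_⟩
  filter_upwards [hw.coeFn_op F] with x hx
  rw [hx]
  by_cases hx : x ∈ E <;> simp [ht, hx]

/-- For z in the range of T*, the fields of all V_i* annihilate z(x) off a single null set, as the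
index set is countable. Carried back to the fibre at x₀, z(x) is orthogonal to every V_i and so
vanishes. -/
theorem inducedOp_jointly_total {V : ∀ i, K' i →ₗᵢ[ℂ] K} (hV : IsHilbertSum ℂ K' V) [Countable ι]
    (hφ : φ.Defines D) (hφ' : ∀ i, (φ' i).Defines (D' i))
    (hI : ∀ i, IsIntertwiner (D' i) D (V i).toContinuousLinearMap)
    {T : Lp K 2 (canonicalMeasure G₀) →L[ℂ] Lp K 2 (canonicalMeasure G₀)}
    (hT : ∀ i F, T (inducedOp (φ' i) φ (V i).toContinuousLinearMap F) = 0) : T = 0 := by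
  suffices h : ContinuousLinearMap.adjoint T = 0 by
    rw [← ContinuousLinearMap.adjoint_adjoint T, h, map_zero]
  ext1 u
  set z := ContinuousLinearMap.adjoint T u with hz
  have h1 : ∀ i, inducedOp φ (φ' i)
      (ContinuousLinearMap.adjoint (V i).toContinuousLinearMap) z = 0 := by
    intro i
    rw [inducedOp_adjoint (hφ' i) hφ (hI i)]
    refine ext_inner_right ℂ fun F => ?_
    rw [ContinuousLinearMap.adjoint_inner_left, hz, ContinuousLinearMap.adjoint_inner_left, hT,
      inner_zero_right, inner_zero_left]
  have h2 : ∀ᵐ x ∂canonicalMeasure G₀, ∀ i, fieldOp φ (φ' i)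
      (ContinuousLinearMap.adjoint (V i).toContinuousLinearMap) x (z x) = 0 := by
    rw [ae_all_iff]
    intro i
    have h3 := coeFn_inducedOp hφ (hφ' i) (hI i).adjoint z
    rw [h1 i] at h3
    filter_upwards [h3, Lp.coeFn_zero (K' i) 2 (canonicalMeasure G₀)] with x h4 h5
    rw [← h4, h5, Pi.zero_apply]
  apply Lp.ext
  filter_upwards [h2, Lp.coeFn_zero K 2 (canonicalMeasure G₀)] with x h3 h4
  rw [zero_apply, h4, Pi.zero_apply]
  set a := φ.f (Quotient.out x) ((1 : G) : G ⧸ G₀) with ha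
  have h5 : innerSL ℂ (a.symm (z x)) = 0 := by
    refine hV.ext_clm fun i v => ?_
    have h6 := h3 i
    rw [fieldOp, conjOp_apply, LinearIsometryEquiv.map_eq_zero_iff] at h6
    rw [innerSL_apply_apply]
    have h7 := ContinuousLinearMap.adjoint_inner_left (V i).toContinuousLinearMap v (a.symm (z x))
    rw [h6, inner_zero_left] at h7
    exact h7.symm
  have h8 : ⟪a.symm (z x), a.symm (z x)⟫_ℂ = 0 := by
    rw [← innerSL_apply_apply, h5, zero_apply]
  rwa [inner_self_eq_zero, LinearIsometryEquiv.map_eq_zero_iff] at h8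

/-- The induced operators of the V_i, composed with the given models, decompose L²(K) into the same
spaces as those in the decomposition of H. The unitary matching the two is the model, and its
properties are checked on each summand. -/
theorem exists_isModel_of_isDirectSum [Countable ι]
    (hM' : ∀ i, IsModel (D' i) (S' i) (φ' i) (W' i)) (hD : D.IsDirectSum D')
    (hS : S.IsDirectSum S') : ∃ φ W, IsModel D S φ W := by
  obtain ⟨V, hV, hVU⟩ := hD
  obtain ⟨R, hR, hRU, hRP⟩ := hS
  obtain ⟨φ, hφV⟩ := StrictCocycle.exists_directSum hV φ'
  have hI : ∀ i, IsIntertwiner (D' i) D (V i).toContinuousLinearMap := fun i g v =>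
    (hVU i g v).symm
  have hφ : φ.Defines D := by
    intro h
    have : φ.toCLM h ((1 : G) : G ⧸ G₀) = D.toCLM h := by
      refine hV.ext_clm fun i v => ?_
      rw [StrictCocycle.toCLM_apply, MRep.toCLM_apply, hφV, hVU, (hM' i).base]
    ext v
    exact DFunLike.congr_fun this v
  have hφ' : ∀ i, (φ' i).Defines (D' i) := fun i => (hM' i).base
  set F := fun i => inducedOp (φ' i) φ (V i).toContinuousLinearMap with hF
  have hg := hV.isGeneratingFamily (fun e : Empty => (e.elim : K →L[ℂ] K))
  have hFF : ∀ i j, ContinuousLinearMap.adjoint (F i) ∘L F j = inducedOp (φ' j) (φ' i)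
      (ContinuousLinearMap.adjoint (V i).toContinuousLinearMap ∘L
        (V j).toContinuousLinearMap) := by
    intro i j
    rw [inducedOp_comp (hφ' j) hφ (hφ' i) (hI j) (hI i).adjoint,
      inducedOp_adjoint (hφ' i) hφ (hI i)]
  have hFiso : ∀ i, ContinuousLinearMap.adjoint (F i) ∘L F i = ContinuousLinearMap.id ℂ _ := by
    intro i
    rw [hFF, hg.isometry i, inducedOp_id (hφ' i)]
  set Q : ∀ i, H' i →ₗᵢ[ℂ] Lp K 2 (canonicalMeasure G₀) := fun i =>
    (isometryOfAdjointComp (F i) (hFiso i)).comp (W' i).toLinearIsometry with hQ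
  have hQa : ∀ i v, Q i v = F i (W' i v) := fun i v => rfl
  have hQsum : IsHilbertSum ℂ H' Q := by
    refine IsHilbertSum.of_total (fun i j hij v w => ?_) fun T hT => ?_
    · have h1 : ContinuousLinearMap.adjoint (F i) ∘L F j = 0 := by
        rw [hFF, hg.orthogonal i j hij]
        have := inducedOp_smul (hφ' j) (hφ' i) 0 (IsIntertwiner.zero (D := D' j) (D' := D' i))
        rwa [zero_smul, zero_smul] at this
      rw [hQa, hQa, ← ContinuousLinearMap.adjoint_inner_right]
      have h2 := DFunLike.congr_fun h1 (W' j w)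
      rw [ContinuousLinearMap.comp_apply] at h2
      rw [h2, zero_apply, inner_zero_right]
    · refine inducedOp_jointly_total hV hφ hφ' hI fun i u => ?_
      have := hT i ((W' i).symm u)
      rwa [hQa, (W' i).apply_symm_apply] at this
  obtain ⟨W, hW⟩ := hR.exists_unitary hQsum
  refine ⟨φ, W, hφ, fun E hE v => ?_, ?_⟩
  · obtain ⟨Z, hZ⟩ := exists_indicator_clm (K := K) hE
    have : (W.toContinuousLinearEquiv : H →L[ℂ] _) ∘L S.P E =
        Z ∘L (W.toContinuousLinearEquiv : H →L[ℂ] _) := by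
      refine hR.ext_clm fun i v => ?_
      change W (S.P E (R i v)) = Z (W (R i v))
      rw [hRP i E hE, hW, hW, hQa, hQa]
      apply Lp.ext
      exact (inducedOp_indicator (hφ' i) hφ (hI i) ((hM' i).proj E hE v)).trans (hZ _).symm
    have h1 : W (S.P E v) = Z (W v) := DFunLike.congr_fun this v
    rw [h1]
    exact hZ _
  -- Countability of the index set gives one conull set of g valid for all summands.
  · filter_upwards [ae_all_iff.2 fun i => (hM' i).unit] with g hg v
    have : (W.toContinuousLinearEquiv : H →L[ℂ] _) ∘L S.toMRep.toCLM g =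
        cocycleOp canonicalMeasure_inInvariantClass φ g ∘L
          (W.toContinuousLinearEquiv : H →L[ℂ] _) := by
      refine hR.ext_clm fun i v => ?_
      change W (S.U g (R i v)) = cocycleOp canonicalMeasure_inInvariantClass φ g (W (R i v))
      rw [hRU, hW, hW, hQa, hQa, hg, inducedOp_cocycleOp (hφ' i) hφ (hI i)]
    exact DFunLike.congr_fun this v

end DirectSum

theorem mainTheorem8
    {G : Type*} [Group G] [TopologicalSpace G] [IsTopologicalGroup G] [LocallyCompactSpace G]
    [SecondCountableTopology G] [T2Space G] [MeasurableSpace G] [BorelSpace G]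
    (G₀ : Subgroup G) (hG₀ : IsClosed (G₀ : Set G)) (m : Multiplier G)
    {K : Type*} [NormedAddCommGroup K] [InnerProductSpace ℂ K] [CompleteSpace K]
    [TopologicalSpace.SeparableSpace K]
    {H : Type*} [NormedAddCommGroup H] [InnerProductSpace ℂ H] [CompleteSpace H]
    (D : MRep (m.restrict G₀) K) (S : MSystem m (G ⧸ G₀) H) :
    (IsAssociated D S →
      Nonempty (D.commutingRing ≃⋆ₐ[ℂ] S.commutingRing) ∧
      (D.IsIrreducible ↔ S.IsIrreducible)) ∧
    (∀ {ι : Type*} [Countable ι] {K' H' : ι → Type*}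
      [∀ i, NormedAddCommGroup (K' i)] [∀ i, InnerProductSpace ℂ (K' i)]
      [∀ i, CompleteSpace (K' i)] [∀ i, TopologicalSpace.SeparableSpace (K' i)]
      [∀ i, NormedAddCommGroup (H' i)] [∀ i, InnerProductSpace ℂ (H' i)]
      [∀ i, CompleteSpace (H' i)]
      (D' : ∀ i, MRep (m.restrict G₀) (K' i)) (S' : ∀ i, MSystem m (G ⧸ G₀) (H' i)),
      (∀ i, IsAssociated (D' i) (S' i)) →
        (D.IsDirectSum D' → (IsAssociated D S ↔ S.IsDirectSum S')) ∧
        (S.IsDirectSum S' → (IsAssociated D S ↔ D.IsDirectSum D'))) := by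
  refine ⟨fun h => ?_, ?_⟩
  · obtain ⟨φ, W, hM⟩ := (isAssociated_iff_exists_isModel D S).1 h
    obtain ⟨e⟩ := hM.nonempty_commutingRing_equiv
    refine ⟨⟨e⟩, ?_⟩
    rw [MRep.isIrreducible_iff, MSystem.isIrreducible_iff]
    exact ⟨fun h => h.of_equiv e, fun h => h.of_equiv e.symm⟩
  · intro ι _ K' H' _ _ _ _ _ _ _ D' S' h
    choose φ' W' hM' using fun i => (isAssociated_iff_exists_isModel (D' i) (S' i)).1 (h i)
    -- Both equivalences in (2) follow from `key` and `key'`: any two of the three properties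
    -- (association and the two decompositions) imply the third.
    have key : IsAssociated D S → (D.IsDirectSum D' ↔ S.IsDirectSum S') := fun h => by
      obtain ⟨φ, W, hM⟩ := (isAssociated_iff_exists_isModel D S).1 h
      exact hM.isDirectSum_iff hM'
    have key' : D.IsDirectSum D' → S.IsDirectSum S' → IsAssociated D S := fun h1 h2 =>
      (isAssociated_iff_exists_isModel D S).2 (exists_isModel_of_isDirectSum hM' h1 h2)
    exact ⟨fun h1 => ⟨fun h2 => (key h2).1 h1, key' h1⟩,
      fun h1 => ⟨fun h2 => (key h2).2 h1, fun h2 => key' h2 h1⟩⟩
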